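/- Let $1 \le r < 2$, let $G$ be a connected finite-dimensional real Lie group with Lie algebra $\mathfrak g = T_1 G$, and let $\|\cdot\|_{\mathfrak g}$ be a norm on $\mathfrak g$. Give each tangent space the left-invariant norm $\|x\|_{T_gG} = \|g^{-1}x\|_{\mathfrak g}$, where $g^{-1}x \in \mathfrak g$ is the image of $x \in T_gG$ under the derivative of left multiplication by $g^{-1}$, and let $d(g,g')$ be the infimum of the lengths $\int \|\gamma'(t)\|_{T_{\gamma(t)}G}\,dt$ over all continuously differentiable paths $\gamma$ in $G$ from $g$ to $g'$. For a smooth curve $\gamma:[a,b]\to G$ define its left trace $\gamma_l:[a,b]\to\mathfrak g$ by $\gamma_l(t)=\int_a^t \gamma(s)^{-1}\gamma'(s)\,ds$, and put $$\|\gamma\|_{V^r}=\sup_{a=t_0<t_1<\dots<t_n=b}\Big(\sum_{j=0}^{n-1} d(\gamma(t_{j+1}),\gamma(t_j))^r\Big)^{1/r},\qquad \|\gamma_l\|_{V^r}=\sup_{a=t_0<t_1<\dots<t_n=b}\Big(\sum_{j=0}^{n-1}\|\gamma_l(t_{j+1})-\gamma_l(t_j)\|_{\mathfrak g}^r\Big)^{1/r}.$$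 Then there is a constant $C>0$, depending only on $r$, $G$ and $\|\cdot\|_{\mathfrak g}$, such that for all $a \le b$ and all smooth curves $\gamma:[a,b]\to G$ both quantities are finite and $$\|\gamma\|_{V^r}\le\|\gamma_l\|_{V^r}+C\min\big(\|\gamma_l\|_{V^r}^2,\|\gamma_l\|_{V^r}^r\big)$$ and $$\|\gamma_l\|_{V^r}\le\|\gamma\|_{V^r}+C\min\big(\|\gamma\|_{V^r}^2,\|\gamma\|_{V^r}^r\big).$$ -/

import Mathlib

open scoped Manifold ContDiff ENNReal

noncomputable section

namespace LieVariation

section Variation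

variable {X : Type*}

/-- The `r`-variation over `[a, b]` of a curve `γ` in a space with (extended) distance function
`d`: the supremum of `(∑ d(γ(t_{j+1}), γ(t_j))^r)^{1/r}` over all partitions
`a = t 0 < t 1 < ... < t n = b`. Only the values of `γ` on `[a, b]` matter. -/
def rVariation (d : X → X → ℝ≥0∞) (r a b : ℝ) (γ : ℝ → X) : ℝ≥0∞ :=
  ⨆ (n : ℕ) (t : ℕ → ℝ) (_ : StrictMonoOn t (Set.Iic n)) (_ : t 0 = a) (_ : t n = b),
    (∑ j ∈ Finset.range n, d (γ (t (j + 1))) (γ (t j)) ^ r) ^ (1 / r)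

end Variation

section LieGroup

variable {E : Type*} [NormedAddCommGroup E] [NormedSpace ℝ E]
  {H : Type*} [TopologicalSpace H] (I : ModelWithCorners ℝ E H)
  {G : Type*} [TopologicalSpace G] [ChartedSpace H G] [Group G]

/-- The map `x ↦ g⁻¹ x` from `T_g G` to the Lie algebra `T_1 G`: the derivative at `g` of left
multiplication by `g⁻¹`. (Its values lie in the tangent space at `g⁻¹ * g`, which is
the tangent space at `1`.) -/
def toLieAlgebra (g : G) (x : TangentSpace I g) : GroupLieAlgebra I G :=
  mfderiv I I (fun h : G ↦ g⁻¹ * h) g x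

/-- The left-invariant norm `‖x‖_{T_g G} = ‖g⁻¹ x‖` on the tangent space at `g` defined by a norm
`N` on the Lie algebra. -/
@[reducible]
def leftInvariantENorm (N : Seminorm ℝ (GroupLieAlgebra I G)) (g : G) : ENorm (TangentSpace I g) :=
  ⟨fun x ↦ ENNReal.ofReal (N (toLieAlgebra I g x))⟩

/-- The left-invariant distance on `G`: the infimum of the lengths
`∫ ‖γ'(t)‖_{T_{γ(t)} G} dt` of the continuously differentiable paths from `g` to `h`. -/
def leftInvariantEDist (N : Seminorm ℝ (GroupLieAlgebra I G)) (g h : G) : ℝ≥0∞ :=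
  letI : ∀ x : G, ENorm (TangentSpace I x) := leftInvariantENorm I N
  Manifold.riemannianEDist I g h

/-- The distance on the Lie algebra defined by a norm `N`. -/
def lieAlgebraEDist (N : Seminorm ℝ (GroupLieAlgebra I G)) (u v : GroupLieAlgebra I G) : ℝ≥0∞ :=
  ENNReal.ofReal (N (u - v))

/-- The velocity `γ(s)⁻¹ γ'(s)` of a curve `γ : [a, b] → G`, pulled back to the Lie algebra. -/
def leftVelocity (a b : ℝ) (γ : ℝ → G) (s : ℝ) : GroupLieAlgebra I G :=
  toLieAlgebra I (γ s) (mfderivWithin 𝓘(ℝ, ℝ) I γ (Set.Icc a b) s (1 : ℝ))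

/-- The left trace `γ_l(t) = ∫_a^t γ(s)⁻¹ γ'(s) ds` of a curve `γ : [a, b] → G`. The integral is
taken in the model space `E`, of which the tangent space at `1` is a synonym (with the same
vector space structure and topology). -/
def leftTrace (a b : ℝ) (γ : ℝ → G) (t : ℝ) : GroupLieAlgebra I G :=
  (∫ s in a..t, (leftVelocity I a b γ s : E) : E)

/-- The `r`-variation `‖γ‖_{V^r}` of a curve `γ : [a, b] → G` in the left-invariant distance. -/
def groupVariation (N : Seminorm ℝ (GroupLieAlgebra I G)) (r a b : ℝ) (γ : ℝ → G) : ℝ≥0∞ :=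
  rVariation (leftInvariantEDist I N) r a b γ

/-- The `r`-variation `‖γ_l‖_{V^r}` of the left trace of a curve `γ : [a, b] → G`, in the distance
of the norm `N` on the Lie algebra. -/
def traceVariation (N : Seminorm ℝ (GroupLieAlgebra I G)) (r a b : ℝ) (γ : ℝ → G) : ℝ≥0∞ :=
  rVariation (lieAlgebraEDist I N) r a b (leftTrace I a b γ)

end LieGroup

end LieVariation

end

noncomputable section

open Set Filter Topology MeasureTheory

namespace LieVariation

section Variation

lemma sum_rpow_le_rpow_sum {ι : Type*} (s : Finset ι) (f : ι → ℝ≥0∞) {p : ℝ} (hp : 1 ≤ p) :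
    ∑ i ∈ s, f i ^ p ≤ (∑ i ∈ s, f i) ^ p := by
  classical
  induction s using Finset.induction_on with
  | empty => simp
  | insert i s hi ih =>
    rw [Finset.sum_insert hi, Finset.sum_insert hi]
    exact (add_le_add_right ih _).trans (ENNReal.add_rpow_le_rpow_add _ _ hp)

variable {X : Type*} {d : X → X → ℝ≥0∞} {r a b s t : ℝ} {c : ℝ → X}

/-- The `r`-th power of the `r`-variation, as a supremum over monotone sequences in `[a, b]`. -/
def powVariation (d : X → X → ℝ≥0∞) (r a b : ℝ) (c : ℝ → X) : ℝ≥0∞ :=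
  ⨆ p : ℕ × {u : ℕ → ℝ // Monotone u ∧ ∀ i, u i ∈ Icc a b},
    ∑ i ∈ Finset.range p.1, d (c (p.2.1 (i + 1))) (c (p.2.1 i)) ^ r

lemma sum_le_powVariation (n : ℕ) {u : ℕ → ℝ} (hu : Monotone u) (hmem : ∀ i, u i ∈ Icc a b) :
    ∑ i ∈ Finset.range n, d (c (u (i + 1))) (c (u i)) ^ r ≤ powVariation d r a b c :=
  le_iSup (fun p : ℕ × {u : ℕ → ℝ // Monotone u ∧ ∀ i, u i ∈ Icc a b} ↦
    ∑ i ∈ Finset.range p.1, d (c (p.2.1 (i + 1))) (c (p.2.1 i)) ^ r) (n, ⟨u, hu, hmem⟩)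

/-- Repeated values of a monotone sequence can be removed without changing a sum over consecutive
values of a function vanishing on the diagonal. -/
lemma exists_strictMonoOn_sum_eq {f : ℝ → ℝ → ℝ≥0∞} (hf : ∀ x, f x x = 0) {u : ℕ → ℝ}
    (hu : Monotone u) (n : ℕ) :
    ∃ (m : ℕ) (t : ℕ → ℝ), StrictMonoOn t (Iic m) ∧ t 0 = u 0 ∧ t m = u n ∧
      ∑ i ∈ Finset.range n, f (u (i + 1)) (u i) = ∑ i ∈ Finset.range m, f (t (i + 1)) (t i) := by
  induction n with
  | zero => exact ⟨0, u, by intro x hx y hy hxy; simp at hx hy; omega, rfl, rfl, by simp⟩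
  | succ n ih =>
    obtain ⟨m, t, ht, h0, hm, hsum⟩ := ih
    rcases (hu n.le_succ).eq_or_lt with h | h
    · refine ⟨m, t, ht, h0, hm.trans h, ?_⟩
      rw [Finset.sum_range_succ, hsum]
      simp only [Nat.succ_eq_add_one] at h
      simp [← h, hf]
    · refine ⟨m + 1, fun i ↦ if i ≤ m then t i else u (n + 1), ?_, by simpa using h0, by simp, ?_⟩
      · intro x hx y hy hxy
        simp only [mem_Iic] at hx hy
        have hxm : x ≤ m := by omega
        simp only [hxm, if_true]
        split_ifs with hym
        · exact ht hxm hym hxy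
        · refine lt_of_le_of_lt ?_ (hm ▸ h)
          exact ht.monotoneOn hxm (by simp) hxm
      · rw [Finset.sum_range_succ, Finset.sum_range_succ, hsum]
        congr 1
        · refine Finset.sum_congr rfl fun i hi ↦ ?_
          simp only [Finset.mem_range] at hi
          simp [hi.le, Nat.succ_le_of_lt hi]
        · simp [hm]

lemma rVariation_rpow (hd : ∀ x, d x x = 0) (hr : 0 < r) (hab : a ≤ b) :
    rVariation d r a b c ^ r = powVariation d r a b c := by
  apply le_antisymm
  · rw [← ENNReal.le_rpow_inv_iff hr, rVariation]
    refine iSup_le fun n ↦ iSup_le fun t ↦ iSup_le fun ht ↦ iSup_le fun h0 ↦ iSup_le fun hn ↦ ?_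
    rw [one_div]
    gcongr
    have hmono : Monotone fun i ↦ t (min i n) := fun i j hij ↦
      ht.monotoneOn (by simp) (by simp) (by omega)
    refine le_trans (le_of_eq ?_) (sum_le_powVariation n hmono fun i ↦ ⟨?_, ?_⟩)
    · refine Finset.sum_congr rfl fun i hi ↦ ?_
      simp only [Finset.mem_range] at hi
      simp [hi.le, Nat.succ_le_of_lt hi]
    · rw [← h0]; exact ht.monotoneOn (by simp) (by simp) (by omega)
    · rw [← hn]; exact ht.monotoneOn (by simp) (by simp) (by omega)
  · refine iSup_le ?_
    rintro ⟨n, u, hu, hmem⟩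
    let w : ℕ → ℝ := fun i ↦ if i = 0 then a else if i ≤ n + 1 then u (i - 1) else b
    have hw : Monotone w := by
      refine monotone_nat_of_le_succ fun i ↦ ?_
      have h1 := fun i ↦ (hmem i).1
      have h2 := fun i ↦ (hmem i).2
      have h3 : u (i - 1) ≤ u i := hu (by omega)
      simp only [w]
      split_ifs <;> first | contradiction | omega | simp [h1, h2, h3]
    obtain ⟨m, t, ht, h0, hm, hsum⟩ := exists_strictMonoOn_sum_eq
      (f := fun x y ↦ d (c x) (c y) ^ r) (fun x ↦ by simp [hd, hr]) hw (n + 2)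
    have key : ∑ i ∈ Finset.range n, d (c (u (i + 1))) (c (u i)) ^ r ≤
        ∑ i ∈ Finset.range m, d (c (t (i + 1))) (c (t i)) ^ r := by
      rw [← hsum, Finset.sum_range_succ, Finset.sum_range_succ']
      refine le_trans ?_ (le_trans le_self_add le_self_add)
      refine Finset.sum_le_sum fun i hi ↦ ?_
      simp only [Finset.mem_range] at hi
      have : i ≤ n := hi.le
      simp [w, this, Nat.succ_le_of_lt hi]
    refine key.trans ?_
    rw [← ENNReal.rpow_inv_le_iff hr, ← one_div, rVariation]
    refine le_trans ?_ (le_iSup _ m)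
    refine le_trans ?_ (le_iSup _ t)
    rw [iSup_pos ht, iSup_pos (h0.trans (by simp [w])), iSup_pos (hm.trans (by simp [w]))]

lemma rVariation_eq_powVariation_rpow (hd : ∀ x, d x x = 0) (hr : 0 < r) (hab : a ≤ b) :
    rVariation d r a b c = powVariation d r a b c ^ (1 / r) := by
  rw [← rVariation_rpow hd hr hab, ← ENNReal.rpow_mul, mul_one_div_cancel hr.ne',
    ENNReal.rpow_one]

lemma powVariation_mono {a' b' : ℝ} (ha : a' ≤ a) (hb : b ≤ b') :
    powVariation d r a b c ≤ powVariation d r a' b' c := by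
  refine iSup_le ?_
  rintro ⟨n, u, hu, hmem⟩
  exact sum_le_powVariation n hu fun i ↦ Icc_subset_Icc ha hb (hmem i)

lemma rpow_le_powVariation (has : a ≤ s) (hst : s ≤ t) (htb : t ≤ b) :
    d (c t) (c s) ^ r ≤ powVariation d r a b c := by
  have hu : Monotone fun i : ℕ ↦ if i = 0 then s else t := by
    refine monotone_nat_of_le_succ fun i ↦ ?_
    by_cases h : i = 0 <;> simp [h, hst]
  have := sum_le_powVariation (d := d) (c := c) (r := r) (a := a) (b := b) 1 hu
    (fun i ↦ by by_cases h : i = 0 <;> simp [h, has, hst.trans htb, has.trans hst, htb])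
  simpa using this

lemma edist_le_rVariation (hd : ∀ x, d x x = 0) (hr : 0 < r) (has : a ≤ s) (hst : s ≤ t)
    (htb : t ≤ b) : d (c t) (c s) ≤ rVariation d r a b c := by
  rw [rVariation_eq_powVariation_rpow hd hr (by linarith), one_div, ENNReal.le_rpow_inv_iff hr]
  exact rpow_le_powVariation has hst htb

lemma powVariation_add_le (has : a ≤ s) (hsb : s ≤ b) :
    powVariation d r a s c + powVariation d r s b c ≤ powVariation d r a b c := by
  have : Nonempty {u : ℕ → ℝ // Monotone u ∧ ∀ i, u i ∈ Icc a s} :=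
    ⟨⟨fun _ ↦ a, monotone_const, fun _ ↦ ⟨le_rfl, has⟩⟩⟩
  have : Nonempty {u : ℕ → ℝ // Monotone u ∧ ∀ i, u i ∈ Icc s b} :=
    ⟨⟨fun _ ↦ s, monotone_const, fun _ ↦ ⟨le_rfl, hsb⟩⟩⟩
  refine ENNReal.iSup_add_iSup_le ?_
  rintro ⟨n, ⟨u, hu, us⟩⟩ ⟨m, ⟨v, hv, vt⟩⟩
  let w i := if i ≤ n then u i else v (i - (n + 1))
  have hw : Monotone w := by
    refine monotone_nat_of_le_succ fun i ↦ ?_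
    simp only [w]
    split_ifs with h1 h2
    · exact hu i.le_succ
    · exact (us _).2.trans (vt _).1
    · omega
    · exact hv (by omega)
  have hmem : ∀ i, w i ∈ Icc a b := fun i ↦ by
    simp only [w]
    split_ifs
    · exact Icc_subset_Icc le_rfl hsb (us _)
    · exact Icc_subset_Icc has le_rfl (vt _)
  refine le_trans ?_ (sum_le_powVariation (n + 1 + m) hw hmem)
  rw [Finset.sum_range_add, Finset.sum_range_succ]
  refine add_le_add (le_trans (le_of_eq ?_) le_self_add) (le_of_eq ?_)
  · refine Finset.sum_congr rfl fun i hi ↦ ?_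
    simp only [Finset.mem_range] at hi
    simp [w, hi.le, Nat.succ_le_of_lt hi]
  · refine Finset.sum_congr rfl fun i _ ↦ ?_
    have h1 : ¬ (n + 1 + i ≤ n) := by omega
    have h2 : ¬ (n + 1 + i + 1 ≤ n) := by omega
    have h3 : n + 1 + i + 1 - (n + 1) = i + 1 := by omega
    have h4 : n + 1 + i - (n + 1) = i := by omega
    simp only [w, h1, h2, h3, h4, if_false]

lemma sum_powVariation_le {u : ℕ → ℝ} (hu : Monotone u) (n : ℕ) :
    ∑ i ∈ Finset.range n, powVariation d r (u i) (u (i + 1)) c ≤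
      powVariation d r (u 0) (u n) c := by
  induction n with
  | zero => simp
  | succ n ih =>
    rw [Finset.sum_range_succ]
    exact (add_le_add_left ih _).trans
      (powVariation_add_le (hu n.zero_le) (hu n.le_succ))

lemma rVariation_self (hd : ∀ x, d x x = 0) (hr : 0 < r) : rVariation d r a a c = 0 := by
  rw [rVariation_eq_powVariation_rpow hd hr le_rfl]
  have : powVariation d r a a c = 0 := by
    rw [← nonpos_iff_eq_zero]
    refine iSup_le ?_
    rintro ⟨n, u, hu, hmem⟩
    simp only [Icc_self, mem_singleton_iff] at hmem
    simp [hmem, hd, hr]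
  simp [this, hr]

/-- The variation is subadditive under concatenation of intervals. -/
lemma rVariation_le_add (hd : ∀ x, d x x = 0) (htri : ∀ x y z, d x z ≤ d x y + d y z)
    (hr : 1 ≤ r) (has : a ≤ s) (hsb : s ≤ b) :
    rVariation d r a b c ≤ rVariation d r a s c + rVariation d r s b c := by
  have hr0 : 0 < r := by linarith
  rw [rVariation_eq_powVariation_rpow hd hr0 (has.trans hsb), one_div, ENNReal.rpow_inv_le_iff hr0]
  refine iSup_le ?_
  rintro ⟨n, u, hu, hmem⟩
  rw [← ENNReal.rpow_inv_le_iff hr0, ← one_div]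
  have hstep : ∀ i, d (c (u (i + 1))) (c (u i)) ≤
      d (c (max (u (i + 1)) s)) (c (max (u i) s)) +
        d (c (min (u (i + 1)) s)) (c (min (u i) s)) := fun i ↦ by
    have hi := hu i.le_succ
    simp only [Nat.succ_eq_add_one] at hi
    rcases le_total s (u i) with h | h
    · simp [h, h.trans hi]
    · rcases le_total s (u (i + 1)) with h' | h'
      · simpa [h, h'] using htri _ _ _
      · simp [h, h', hd]
  calc _ ≤ (∑ i ∈ Finset.range n, (d (c (max (u (i + 1)) s)) (c (max (u i) s)) +
        d (c (min (u (i + 1)) s)) (c (min (u i) s))) ^ r) ^ (1 / r) := by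
        gcongr with i _
        exact hstep i
    _ ≤ _ := ENNReal.Lp_add_le _ _ _ hr
    _ ≤ rVariation d r s b c + rVariation d r a s c := by
      rw [rVariation_eq_powVariation_rpow hd hr0 has, rVariation_eq_powVariation_rpow hd hr0 hsb]
      gcongr
      · exact sum_le_powVariation (u := fun i ↦ max (u i) s) n
          (fun i j hij ↦ max_le_max_right _ (hu hij))
          fun i ↦ ⟨le_max_right _ _, max_le (hmem i).2 hsb⟩
      · exact sum_le_powVariation (u := fun i ↦ min (u i) s) n
          (fun i j hij ↦ min_le_min_right _ (hu hij))
          fun i ↦ ⟨le_min (hmem i).1 has, min_le_right _ _⟩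
    _ = _ := add_comm _ _

lemma rVariation_mono {a' b' : ℝ} (hd : ∀ x, d x x = 0) (hr : 0 < r) (ha : a' ≤ a) (hab : a ≤ b)
    (hb : b ≤ b') : rVariation d r a b c ≤ rVariation d r a' b' c := by
  rw [rVariation_eq_powVariation_rpow hd hr hab,
    rVariation_eq_powVariation_rpow hd hr (ha.trans (hab.trans hb))]
  gcongr
  exact powVariation_mono ha hb

/-- A Lipschitz curve has finite variation on bounded intervals, controlled by their length. -/
lemma rVariation_le_of_lipschitz (hd : ∀ x, d x x = 0) (hr : 1 ≤ r) (hab : a ≤ b) {M : ℝ}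
    (hM : 0 ≤ M)
    (hlip : ∀ s t, a ≤ s → s ≤ t → t ≤ b → d (c t) (c s) ≤ ENNReal.ofReal (M * (t - s))) :
    rVariation d r a b c ≤ ENNReal.ofReal (M * (b - a)) := by
  have hr0 : 0 < r := by linarith
  rw [rVariation_eq_powVariation_rpow hd hr0 hab, one_div, ENNReal.rpow_inv_le_iff hr0]
  refine iSup_le ?_
  rintro ⟨n, u, hu, hmem⟩
  have hsum : ∑ i ∈ Finset.range n, ENNReal.ofReal (M * (u (i + 1) - u i)) =
      ENNReal.ofReal (M * (u n - u 0)) := by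
    rw [← ENNReal.ofReal_sum_of_nonneg, ← Finset.mul_sum, Finset.sum_range_sub]
    exact fun i _ ↦ mul_nonneg hM (sub_nonneg.2 (hu i.le_succ))
  calc _ ≤ ∑ i ∈ Finset.range n, ENNReal.ofReal (M * (u (i + 1) - u i)) ^ r := by
        gcongr with i _
        exact hlip _ _ (hmem i).1 (hu i.le_succ) (hmem _).2
    _ ≤ (∑ i ∈ Finset.range n, ENNReal.ofReal (M * (u (i + 1) - u i))) ^ r := sum_rpow_le_rpow_sum _ _ hr
    _ ≤ _ := by
        rw [hsum]
        gcongr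
        · exact (hmem n).2
        · exact (hmem 0).1

/-- Greedy covering: if `W` is superadditive, `V` is subadditive, and `V` is at most `B` on all
pairs where `W` is at most `θ`, including consecutive ones, then `V` is controlled linearly
by `W`. -/
lemma mul_le_of_greedy {V W : ℕ → ℕ → ℝ≥0∞} {B θ : ℝ≥0∞}
    (hV : ∀ i j k, i ≤ j → j ≤ k → V i k ≤ V i j + V j k)
    (hW : ∀ i j k, i ≤ j → j ≤ k → W i j + W j k ≤ W i k)
    (hVW : ∀ i j, i ≤ j → W i j ≤ θ → V i j ≤ B) (hstep : ∀ i, W i (i + 1) ≤ θ) (m : ℕ) :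
    ∀ i, θ * V i (i + m) ≤ B * (2 * W i (i + m) + θ) := by
  induction m using Nat.strong_induction_on with
  | _ m ih =>
    intro i
    by_cases hm : W i (i + m) ≤ θ
    · calc θ * V i (i + m) ≤ θ * B := by gcongr; exact hVW _ _ (by omega) hm
        _ = B * θ := mul_comm _ _
        _ ≤ _ := by gcongr; exact le_add_self
    · have hex : ∃ j, ¬ W i (i + j) ≤ θ := ⟨m, hm⟩
      classical
      obtain ⟨j, hj⟩ : ∃ j, Nat.find hex = j + 1 := by
        refine Nat.exists_eq_succ_of_ne_zero fun h0 ↦ ?_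
        have h := Nat.find_spec hex
        rw [h0] at h
        exact h (le_trans (le_trans le_self_add (hW i i (i + 1) le_rfl (by omega))) (hstep i))
      have hbig : θ ≤ W i (i + j + 1) := by
        have h := Nat.find_spec hex
        rw [hj] at h
        exact (not_le.1 h).le
      have hsmall : W i (i + j) ≤ θ := by
        have h := Nat.find_min hex (m := j) (by omega)
        exact not_not.1 h
      have hjm : j + 1 ≤ m := hj ▸ Nat.find_min' hex hm
      obtain ⟨l, rfl⟩ := Nat.exists_eq_add_of_le hjm
      have e : i + (j + 1 + l) = i + j + 1 + l := by omega
      rw [e]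
      calc θ * V i (i + j + 1 + l)
          ≤ θ * (V i (i + j) + V (i + j) (i + j + 1) + V (i + j + 1) (i + j + 1 + l)) := by
            gcongr
            refine (hV i (i + j + 1) _ (by omega) (by omega)).trans ?_
            gcongr
            exact hV _ _ _ (by omega) (by omega)
        _ = θ * V i (i + j) + θ * V (i + j) (i + j + 1) +
            θ * V (i + j + 1) (i + j + 1 + l) := by ring
        _ ≤ θ * B + θ * B + B * (2 * W (i + j + 1) (i + j + 1 + l) + θ) := by
            refine add_le_add (add_le_add ?_ ?_) (ih l (by omega) _)
            · gcongr; exact hVW _ _ (by omega) hsmall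
            · gcongr; exact hVW _ _ (by omega) (hstep _)
        _ = B * (2 * (θ + W (i + j + 1) (i + j + 1 + l)) + θ) := by ring
        _ ≤ _ := by
            gcongr
            exact (add_le_add_left hbig _).trans (hW _ _ _ (by omega) (by omega))

/-- A uniform grid of mesh `h` in `[a, b]`. -/
def grid (a b h : ℝ) (i : ℕ) : ℝ := min (a + i * h) b

lemma grid_mono {h : ℝ} (hh : 0 ≤ h) : Monotone (grid a b h) := fun i j hij ↦ by
  have : (i : ℝ) ≤ j := by exact_mod_cast hij
  unfold grid
  gcongr

lemma grid_zero {h : ℝ} (hab : a ≤ b) : grid a b h 0 = a := by simp [grid, hab]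

lemma grid_mem {h : ℝ} (hh : 0 ≤ h) (hab : a ≤ b) (i : ℕ) : grid a b h i ∈ Icc a b :=
  ⟨le_min (by nlinarith [(Nat.cast_nonneg i : (0 : ℝ) ≤ i)]) hab, min_le_right _ _⟩

lemma grid_succ_sub_le {h : ℝ} (hh : 0 ≤ h) (i : ℕ) :
    grid a b h (i + 1) - grid a b h i ≤ h := by
  unfold grid
  push_cast
  rcases le_total (a + i * h) b with h1 | h1
  · rw [min_eq_left h1]; linarith [min_le_left (a + (i + 1) * h) b]
  · rw [min_eq_right h1]; linarith [min_le_right (a + (i + 1) * h) b]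

lemma exists_grid_eq {h : ℝ} (hh : 0 < h) : ∃ n, grid a b h n = b := by
  obtain ⟨n, hn⟩ := exists_nat_ge ((b - a) / h)
  refine ⟨n, min_eq_right ?_⟩
  rw [div_le_iff₀ hh] at hn
  linarith

/-- Comparison of variations from a local comparison with quadratic error: if on all subintervals
where the variation of `c₂` is at most `δ` the distance of the endpoints of `c₁` is bounded by that
of `c₂` up to the square of the variation of `c₂`, the variations compare globally. -/
theorem rVariation_le_of_local {Y : Type*} {d₁ : X → X → ℝ≥0∞} {d₂ : Y → Y → ℝ≥0∞}
    {c₁ : ℝ → X} {c₂ : ℝ → Y} {δ K : ℝ} (hr : 1 ≤ r) (hr2 : r < 2) (hδ : 0 < δ) (hδ1 : δ ≤ 1)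
    (hK : 0 ≤ K) (hab : a ≤ b) (hd₁ : ∀ x, d₁ x x = 0)
    (htri : ∀ x y z, d₁ x z ≤ d₁ x y + d₁ y z) (hd₂ : ∀ x, d₂ x x = 0)
    (hloc : ∀ s t, a ≤ s → s ≤ t → t ≤ b → rVariation d₂ r s t c₂ ≤ ENNReal.ofReal δ →
      d₁ (c₁ t) (c₁ s) ≤ d₂ (c₂ t) (c₂ s) + ENNReal.ofReal K * rVariation d₂ r s t c₂ ^ 2)
    (hfine : ∃ h > 0, ∀ s t, a ≤ s → s ≤ t → t ≤ b → t - s ≤ h →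
      rVariation d₂ r s t c₂ ≤ ENNReal.ofReal δ) :
    rVariation d₁ r a b c₁ ≤ rVariation d₂ r a b c₂ + ENNReal.ofReal (3 * (1 + K) / δ ^ 2) *
      min (rVariation d₂ r a b c₂ ^ 2) (rVariation d₂ r a b c₂ ^ r) := by
  have hr0 : 0 < r := by linarith
  have small : ∀ s t, a ≤ s → s ≤ t → t ≤ b → rVariation d₂ r s t c₂ ≤ ENNReal.ofReal δ →
      rVariation d₁ r s t c₁ ≤
        rVariation d₂ r s t c₂ + ENNReal.ofReal K * rVariation d₂ r s t c₂ ^ 2 := by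
    intro s t has hst htb hV
    rw [rVariation_eq_powVariation_rpow hd₁ hr0 hst, one_div, ENNReal.rpow_inv_le_iff hr0]
    refine iSup_le ?_
    rintro ⟨n, u, hu, hmem⟩
    rw [← ENNReal.rpow_inv_le_iff hr0, ← one_div]
    have hV' : ∀ i, rVariation d₂ r (u i) (u (i + 1)) c₂ ≤ ENNReal.ofReal δ := fun i ↦
      (rVariation_mono hd₂ hr0 (hmem i).1 (hu i.le_succ) (hmem _).2).trans hV
    calc _ ≤ (∑ i ∈ Finset.range n, (d₂ (c₂ (u (i + 1))) (c₂ (u i)) +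
          ENNReal.ofReal K * rVariation d₂ r (u i) (u (i + 1)) c₂ ^ 2) ^ r) ^ (1 / r) := by
          gcongr with i _
          exact hloc _ _ (has.trans (hmem i).1) (hu i.le_succ) ((hmem _).2.trans htb) (hV' i)
      _ ≤ _ := ENNReal.Lp_add_le _ _ _ hr
      _ ≤ _ := by
          gcongr
          · rw [rVariation_eq_powVariation_rpow hd₂ hr0 hst]
            gcongr
            exact sum_le_powVariation n hu hmem
          · rw [one_div, ENNReal.rpow_inv_le_iff hr0, ENNReal.mul_rpow_of_nonneg _ _ hr0.le]
            simp_rw [ENNReal.mul_rpow_of_nonneg _ _ hr0.le]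
            rw [← Finset.mul_sum]
            gcongr
            have e : ∀ s t : ℝ, s ≤ t → (rVariation d₂ r s t c₂ ^ 2) ^ r =
                powVariation d₂ r s t c₂ ^ (2 : ℝ) := fun s t hst ↦ by
              rw [← rVariation_rpow hd₂ hr0 hst, ← ENNReal.rpow_mul, mul_comm, ENNReal.rpow_mul]
              norm_num
            rw [e s t hst]
            calc _ = ∑ i ∈ Finset.range n, powVariation d₂ r (u i) (u (i + 1)) c₂ ^ (2 : ℝ) :=
                  Finset.sum_congr rfl fun i _ ↦ e _ _ (hu i.le_succ)
              _ ≤ _ := sum_rpow_le_rpow_sum _ _ one_le_two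
              _ ≤ _ := by
                  gcongr
                  exact (sum_powVariation_le hu n).trans
                    (powVariation_mono (hmem 0).1 (hmem n).2)
  set V := rVariation d₂ r a b c₂ with hVdef
  have hKC : ENNReal.ofReal K ≤ ENNReal.ofReal (3 * (1 + K) / δ ^ 2) := by
    apply ENNReal.ofReal_le_ofReal
    rw [le_div_iff₀ (by positivity)]
    nlinarith [mul_le_one₀ hδ1 hδ.le hδ1]
  rcases le_or_gt V (ENNReal.ofReal δ) with hV | hV
  · refine (small a b le_rfl hab le_rfl hV).trans ?_
    gcongr
    refine le_min le_rfl ?_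
    rw [← ENNReal.rpow_two]
    exact ENNReal.rpow_le_rpow_of_exponent_ge
      (hV.trans (by simpa using hδ1)) hr2.le
  rcases eq_or_ne V ⊤ with hT | hT
  · simp [hT]
  refine le_trans ?_ le_add_self
  obtain ⟨h, hh, hfine⟩ := hfine
  obtain ⟨n, hn⟩ := exists_grid_eq (a := a) (b := b) hh
  have gm : Monotone (grid a b h) := grid_mono hh.le
  have gmem := grid_mem hh.le hab
  set θ : ℝ≥0∞ := ENNReal.ofReal δ ^ r with hθ
  have hθle : ∀ s t, s ≤ t → (powVariation d₂ r s t c₂ ≤ θ ↔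
      rVariation d₂ r s t c₂ ≤ ENNReal.ofReal δ) := fun s t hst ↦ by
    rw [← rVariation_rpow hd₂ hr0 hst, hθ, ENNReal.rpow_le_rpow_iff hr0]
  have main := mul_le_of_greedy
    (V := fun i j ↦ rVariation d₁ r (grid a b h i) (grid a b h j) c₁)
    (W := fun i j ↦ powVariation d₂ r (grid a b h i) (grid a b h j) c₂)
    (B := ENNReal.ofReal (1 + K)) (θ := θ)
    (fun i j k hij hjk ↦ rVariation_le_add hd₁ htri hr (gm hij) (gm hjk))
    (fun i j k hij hjk ↦ powVariation_add_le (gm hij) (gm hjk))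
    (fun i j hij hW ↦ by
      have hV := (hθle _ _ (gm hij)).1 hW
      refine (small _ _ (gmem i).1 (gm hij) (gmem j).2 hV).trans ?_
      have h1 : rVariation d₂ r (grid a b h i) (grid a b h j) c₂ ≤ 1 :=
        hV.trans (by simpa using hδ1)
      rw [ENNReal.ofReal_add zero_le_one hK, ENNReal.ofReal_one]
      gcongr
      exact mul_le_of_le_one_right' (pow_le_one' h1 2))
    (fun i ↦ (hθle _ _ (gm i.le_succ)).2
      (hfine _ _ (gmem i).1 (gm i.le_succ) (gmem _).2 (grid_succ_sub_le hh.le i))) n 0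
  simp only [zero_add, grid_zero hab, hn] at main
  have hVθ : θ ≤ powVariation d₂ r a b c₂ := by
    rw [← rVariation_rpow hd₂ hr0 hab]
    exact ENNReal.rpow_le_rpow hV.le hr0.le
  rw [← rVariation_rpow hd₂ hr0 hab, ← hVdef] at main hVθ
  have hδ' : ENNReal.ofReal δ ≠ 0 := by simpa using hδ
  have hθ0 : θ ≠ 0 := by simp [hθ, hδ, hr0]
  have hθT : θ ≠ ⊤ := by simp [hθ, hr0.le]
  have main' : θ * rVariation d₁ r a b c₁ ≤ ENNReal.ofReal (3 * (1 + K)) * V ^ r := by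
    refine main.trans ?_
    rw [ENNReal.ofReal_mul (by norm_num), mul_comm (ENNReal.ofReal 3), mul_assoc]
    gcongr
    calc _ ≤ 2 * V ^ r + V ^ r := by gcongr
      _ = 3 * V ^ r := by ring
      _ = _ := by simp
  set δ' : ℝ≥0∞ := ENNReal.ofReal δ with hδdef
  have hδT : δ' ≠ ⊤ := ENNReal.ofReal_ne_top
  have hquot : V ^ r / θ = (V / δ') ^ r := (ENNReal.div_rpow_of_nonneg _ _ hr0.le).symm
  have hmin : V ^ r / θ ≤ min (V ^ 2) (V ^ r) / δ' ^ 2 := by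
    rcases min_cases (V ^ 2) (V ^ r) with ⟨h1, -⟩ | ⟨h1, -⟩ <;> rw [h1]
    · rw [hquot, ← ENNReal.rpow_two, ← ENNReal.rpow_two, ← ENNReal.div_rpow_of_nonneg _ _ zero_le_two]
      refine ENNReal.rpow_le_rpow_of_exponent_le ?_ hr2.le
      rw [ENNReal.le_div_iff_mul_le (Or.inl hδ') (Or.inl hδT), one_mul]
      exact hV.le
    · gcongr
      rw [← ENNReal.rpow_two, hθ]
      exact ENNReal.rpow_le_rpow_of_exponent_ge (by simpa [hδdef] using hδ1) hr2.le
  calc rVariation d₁ r a b c₁ ≤ ENNReal.ofReal (3 * (1 + K)) * V ^ r / θ := by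
        rw [ENNReal.le_div_iff_mul_le (Or.inl hθ0) (Or.inl hθT), mul_comm]
        exact main'
    _ = ENNReal.ofReal (3 * (1 + K)) * (V ^ r / θ) := mul_div_assoc _ _ _
    _ ≤ ENNReal.ofReal (3 * (1 + K)) * (min (V ^ 2) (V ^ r) / δ' ^ 2) := by gcongr
    _ = _ := by
        rw [ENNReal.ofReal_div_of_pos (by positivity), ENNReal.ofReal_pow hδ.le, ← hδdef]
        simp only [div_eq_mul_inv]
        ring

end Variation

section Sewing

/-- A superadditive function of intervals can be halved at a single step. -/
lemma exists_halving {Ω : ℕ → ℕ → ℝ} (h0 : ∀ i j, 0 ≤ Ω i j)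
    (hΩ : ∀ i j k, i ≤ j → j ≤ k → Ω i j + Ω j k ≤ Ω i k) {i k : ℕ} (hik : i < k) :
    ∃ j, i ≤ j ∧ j < k ∧ Ω i j ≤ Ω i k / 2 ∧ Ω (j + 1) k ≤ Ω i k / 2 := by
  have hdiag : ∀ j, Ω j j ≤ 0 := fun j ↦ by linarith [hΩ j j j le_rfl le_rfl]
  by_cases hex : ∃ j, i ≤ j ∧ j ≤ k ∧ Ω i k / 2 < Ω i j
  · classical
    obtain ⟨hij, hjk, hj⟩ := Nat.find_spec hex
    have hne : Nat.find hex ≠ i := fun h ↦ by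
      rw [h] at hj
      linarith [hdiag i, h0 i k]
    obtain ⟨j, hj'⟩ := Nat.exists_eq_add_one_of_ne_zero (n := Nat.find hex) (by omega)
    have hmin := Nat.find_min hex (m := j) (by omega)
    rw [hj'] at hij hjk hj
    refine ⟨j, by omega, by omega, ?_, ?_⟩
    · by_contra hcon
      exact hmin ⟨by omega, by omega, not_le.1 hcon⟩
    · linarith [hΩ i (j + 1) k (by omega) hjk]
  · push Not at hex
    refine ⟨k - 1, by omega, by omega, hex _ (by omega) (by omega), ?_⟩
    rw [Nat.sub_add_cancel (by omega)]
    linarith [hdiag k, h0 i k]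

/-- The constant of the sewing estimate. -/
def sewingConst (θ A C : ℝ) : ℝ := 4 * C * A ^ 2 / (1 - 2 ^ (1 - θ))

lemma one_sub_two_rpow_pos {θ : ℝ} (hθ : 1 < θ) : 0 < 1 - (2 : ℝ) ^ (1 - θ) :=
  sub_pos.2 (Real.rpow_lt_one_of_one_lt_of_neg one_lt_two (by linarith))

lemma sewingConst_nonneg {θ A C : ℝ} (hθ : 1 < θ) (hC : 0 ≤ C) : 0 ≤ sewingConst θ A C :=
  div_nonneg (by positivity) (one_sub_two_rpow_pos hθ).le

variable {G E : Type*} [Group G] [NormedAddCommGroup E]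

/-- Sewing estimate: `L` is an almost homomorphism near the identity of `G`, `g` a sequence in `G`
whose one-step increments have `L`-image close to the increments of `x`; then the same holds for
increments over many steps, with an error quadratic in the control `Ω`. -/
theorem sewing_estimate {L : G → E} {V : Set G} {C ρ A θ w₀ : ℝ}
    (hC : 0 ≤ C) (hA : 0 ≤ A) (hθ : 1 < θ) (h1V : (1 : G) ∈ V) (hL1 : L 1 = 0)
    (hmul : ∀ g ∈ V, ∀ h ∈ V, ‖L (g * h) - L g - L h‖ ≤ C * ‖L g‖ * ‖L h‖)
    (hmem : ∀ g ∈ V, ∀ h ∈ V, ‖L (g * h)‖ < ρ → g * h ∈ V)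
    (hw₁ : C * A * w₀ ^ (θ / 2) ≤ 1) (hw₂ : 7 * A * w₀ ^ (θ / 2) < ρ)
    {g : ℕ → G} {x : ℕ → E} {e : ℕ → ℝ} {Ω : ℕ → ℕ → ℝ} (hΩ0 : ∀ i j, 0 ≤ Ω i j)
    (hΩ : ∀ i j k, i ≤ j → j ≤ k → Ω i j + Ω j k ≤ Ω i k)
    (hΩle : ∀ i j, i ≤ j → Ω i j ≤ w₀)
    (hsmall : ∀ i j, i ≤ j → (g i)⁻¹ * g j ∈ V →
      ‖L ((g i)⁻¹ * g j) - (x j - x i)‖ ≤ sewingConst θ A C * Ω i j ^ θ + (e j - e i) →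
      ‖L ((g i)⁻¹ * g j)‖ ≤ A * Ω i j ^ (θ / 2))
    (hstepV : ∀ i, (g i)⁻¹ * g (i + 1) ∈ V)
    (hstep : ∀ i, ‖L ((g i)⁻¹ * g (i + 1)) - (x (i + 1) - x i)‖ ≤ e (i + 1) - e i) (m : ℕ) :
    ∀ i, (g i)⁻¹ * g (i + m) ∈ V ∧
      ‖L ((g i)⁻¹ * g (i + m)) - (x (i + m) - x i)‖ ≤
        sewingConst θ A C * Ω i (i + m) ^ θ + (e (i + m) - e i) := by
  have hK0 := sewingConst_nonneg (A := A) hθ hC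
  induction m using Nat.strong_induction_on with
  | _ m ih =>
    intro i
    rcases Nat.eq_zero_or_pos m with rfl | hm
    · simp only [add_zero, inv_mul_cancel, hL1, sub_self, norm_zero]
      exact ⟨h1V, by have := Real.rpow_nonneg (hΩ0 i i) θ; positivity⟩
    obtain ⟨j, hij, hjk, hl, hr⟩ := exists_halving hΩ0 hΩ (show i < i + m by omega)
    obtain ⟨p, rfl⟩ := Nat.exists_eq_add_of_le hij
    obtain ⟨q, hq⟩ := Nat.exists_eq_add_of_le (show i + p + 1 ≤ i + m by omega)
    rw [hq] at hl hr ⊢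
    obtain ⟨aV, aD⟩ := ih p (by omega) i
    obtain ⟨bV, bD⟩ := ih q (by omega) (i + p + 1)
    have mV := hstepV (i + p)
    have mD := hstep (i + p)
    set w := Ω i (i + p + 1 + q) with hw
    have hw0 : 0 ≤ w := hΩ0 _ _
    set κ := w ^ (θ / 2) with hκ
    have hκ0 : 0 ≤ κ := Real.rpow_nonneg hw0 _
    have hκκ : κ ^ 2 = w ^ θ := by
      rw [hκ, ← Real.rpow_natCast, ← Real.rpow_mul hw0]; congr 1; push_cast; ring
    have hκle : κ ≤ w₀ ^ (θ / 2) :=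
      Real.rpow_le_rpow hw0 (hΩle _ _ (by omega)) (by linarith)
    have hb1 : C * A * κ ≤ 1 := le_trans (by gcongr) hw₁
    have hb2 : 7 * A * κ < ρ := lt_of_le_of_lt (by gcongr) hw₂
    have hmono : ∀ i' j', i ≤ i' → i' ≤ j' → j' ≤ i + p + 1 + q → Ω i' j' ≤ w := by
      intro i' j' h1 h2 h3
      have e1 := hΩ i i' j' h1 h2
      have e2 := hΩ i j' (i + p + 1 + q) (by omega) h3
      linarith [hΩ0 i i', hΩ0 j' (i + p + 1 + q)]
    have hbd : ∀ i' j', i ≤ i' → i' ≤ j' → j' ≤ i + p + 1 + q →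
        A * Ω i' j' ^ (θ / 2) ≤ A * κ := fun i' j' h1 h2 h3 ↦ by
      gcongr
      exact Real.rpow_le_rpow (hΩ0 _ _) (hmono _ _ h1 h2 h3) (by linarith)
    have aL := (hsmall _ _ (by omega) aV aD).trans (hbd _ _ le_rfl (by omega) (by omega))
    have bL := (hsmall _ _ (by omega) bV bD).trans (hbd _ _ (by omega) (by omega) le_rfl)
    have mL := (hsmall _ _ (by omega) mV (mD.trans
      (le_add_of_nonneg_left (mul_nonneg hK0 (Real.rpow_nonneg (hΩ0 _ _) _))))).trans
      (hbd _ _ (by omega) (by omega) (by omega))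
    set a := (g i)⁻¹ * g (i + p)
    set u := (g (i + p))⁻¹ * g (i + p + 1)
    set b := (g (i + p + 1))⁻¹ * g (i + p + 1 + q)
    have habu : (g i)⁻¹ * g (i + p + 1 + q) = a * u * b := by simp [a, u, b, mul_assoc]
    rw [habu]
    have hAκ : 0 ≤ A * κ := mul_nonneg hA hκ0
    have e1 : ‖L (a * u) - L a - L u‖ ≤ C * A ^ 2 * κ ^ 2 :=
      (hmul a aV u mV).trans (by
        calc C * ‖L a‖ * ‖L u‖ ≤ C * (A * κ) * (A * κ) := by gcongr
          _ = _ := by ring)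
    have hquad : C * A ^ 2 * κ ^ 2 ≤ A * κ := by
      calc C * A ^ 2 * κ ^ 2 = (C * A * κ) * (A * κ) := by ring
        _ ≤ 1 * (A * κ) := by gcongr
        _ = _ := one_mul _
    have auL : ‖L (a * u)‖ ≤ 3 * (A * κ) := by
      calc ‖L (a * u)‖ = ‖(L (a * u) - L a - L u) + L a + L u‖ := by congr 1; abel
        _ ≤ ‖L (a * u) - L a - L u‖ + ‖L a‖ + ‖L u‖ := norm_add₃_le
        _ ≤ _ := by linarith
    have auV : a * u ∈ V := hmem a aV u mV (by linarith)
    have e2 : ‖L (a * u * b) - L (a * u) - L b‖ ≤ 3 * (C * A ^ 2 * κ ^ 2) :=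
      (hmul _ auV b bV).trans (by
        calc C * ‖L (a * u)‖ * ‖L b‖ ≤ C * (3 * (A * κ)) * (A * κ) := by gcongr
          _ = _ := by ring)
    refine ⟨hmem _ auV b bV ?_, ?_⟩
    · calc ‖L (a * u * b)‖ = ‖(L (a * u * b) - L (a * u) - L b) + L (a * u) + L b‖ := by
            congr 1; abel
        _ ≤ ‖L (a * u * b) - L (a * u) - L b‖ + ‖L (a * u)‖ + ‖L b‖ := norm_add₃_le
        _ < ρ := by linarith
    · have hhalf : ∀ y, 0 ≤ y → y ≤ w / 2 → y ^ θ ≤ 2 ^ (-θ) * w ^ θ := fun y hy hyw ↦ by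
        refine (Real.rpow_le_rpow hy hyw (by linarith)).trans (le_of_eq ?_)
        rw [Real.div_rpow hw0 zero_le_two, Real.rpow_neg zero_le_two]
        ring
      have ha2 := mul_le_mul_of_nonneg_left (hhalf _ (hΩ0 _ _) hl) hK0
      have hb2 := mul_le_mul_of_nonneg_left (hhalf _ (hΩ0 _ _) hr) hK0
      have hKeq : 2 * (sewingConst θ A C * (2 ^ (-θ) * w ^ θ)) + 4 * (C * A ^ 2 * κ ^ 2) =
          sewingConst θ A C * w ^ θ := by
        have hp := (one_sub_two_rpow_pos hθ).ne'
        have h2 : (2 : ℝ) ^ (1 - θ) = 2 * 2 ^ (-θ) := by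
          rw [sub_eq_add_neg, Real.rpow_add two_pos, Real.rpow_one]
        have h3 : sewingConst θ A C * (1 - 2 * 2 ^ (-θ)) = 4 * C * A ^ 2 := by
          rw [← h2, sewingConst, div_mul_cancel₀ _ hp]
        rw [hκκ]
        linear_combination (-w ^ θ) * h3
      calc ‖L (a * u * b) - (x (i + p + 1 + q) - x i)‖
          = ‖(L (a * u * b) - L (a * u) - L b) + (L (a * u) - L a - L u) +
            (L a - (x (i + p) - x i)) + (L u - (x (i + p + 1) - x (i + p))) +
            (L b - (x (i + p + 1 + q) - x (i + p + 1)))‖ := by congr 1; abel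
        _ ≤ ‖L (a * u * b) - L (a * u) - L b‖ + ‖L (a * u) - L a - L u‖ +
            ‖L a - (x (i + p) - x i)‖ + ‖L u - (x (i + p + 1) - x (i + p))‖ +
            ‖L b - (x (i + p + 1 + q) - x (i + p + 1))‖ :=
          (norm_add_le _ _).trans (add_le_add_left ((norm_add_le _ _).trans
            (add_le_add_left norm_add₃_le _)) _)
        _ ≤ _ := by linarith

end Sewing

section Calculus

variable {E : Type*} [NormedAddCommGroup E] [NormedSpace ℝ E]

/-- A `C^2` local operation with two-sided unit `0` is addition up to a bilinear error. -/
lemma exists_norm_sub_sub_le {f : E × E → E} (hf : ContDiffAt ℝ 2 f 0)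
    (h₁ : ∀ᶠ y in 𝓝 (0 : E), f (y, 0) = y) (h₂ : ∀ᶠ z in 𝓝 (0 : E), f (0, z) = z) :
    ∃ C : ℝ, 0 ≤ C ∧ ∃ ρ > 0, ∀ y z, ‖y‖ < ρ → ‖z‖ < ρ → ‖f (y, z) - y - z‖ ≤ C * ‖y‖ * ‖z‖ := by
  obtain ⟨K, t, ht, hK⟩ :=
    (hf.fderiv_right (m := 1) (by norm_num)).exists_lipschitzOnWith
  have hd : ∀ᶠ p in 𝓝 (0 : E × E), DifferentiableAt ℝ f p :=
    (hf.eventually (by simp)).mono fun p hp ↦ hp.differentiableAt two_ne_zero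
  obtain ⟨ε₁, hε₁, hb₁⟩ := Metric.eventually_nhds_iff.1 (hd.and ht)
  obtain ⟨ε₂, hε₂, hb₂⟩ := Metric.eventually_nhds_iff.1 (h₁.and h₂)
  refine ⟨K, K.2, min ε₁ ε₂, lt_min hε₁ hε₂, fun y z hy hz ↦ ?_⟩
  have hyz : ∀ y z : E, ‖y‖ < min ε₁ ε₂ → ‖z‖ < min ε₁ ε₂ → dist (y, z) 0 < ε₁ :=
    fun y z hy hz ↦ by
      rw [dist_zero_right, Prod.norm_mk]
      exact max_lt (hy.trans_le (min_le_left _ _)) (hz.trans_le (min_le_left _ _))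
  have h0 : ‖(0 : E)‖ < min ε₁ ε₂ := by simp [hε₁, hε₂]
  have hder : ∀ x : E, ‖x‖ < min ε₁ ε₂ → ∀ z ∈ Metric.ball (0 : E) (min ε₁ ε₂),
      HasFDerivWithinAt (fun z ↦ f (x, z)) ((fderiv ℝ f (x, z)).comp
        (ContinuousLinearMap.inr ℝ E E)) (Metric.ball (0 : E) (min ε₁ ε₂)) z := fun x hx z hz ↦ by
    have h := (hb₁ (hyz x z hx (by simpa using hz))).1.hasFDerivAt
    exact (h.comp z (hasFDerivAt_prodMk_right x z)).hasFDerivWithinAt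
  have := (convex_ball (0 : E) (min ε₁ ε₂)).norm_image_sub_le_of_norm_hasFDerivWithin_le
    (f := fun z ↦ f (y, z) - f (0, z)) (C := K * ‖y‖)
    (fun z hz ↦ (hder y hy z hz).sub (hder 0 h0 z hz))
    (fun z hz ↦ by
      rw [← ContinuousLinearMap.sub_comp]
      have hz' : ‖z‖ < min ε₁ ε₂ := by simpa using hz
      have hl := hK.norm_sub_le (hb₁ (hyz y z hy hz')).2 (hb₁ (hyz 0 z h0 hz')).2
      refine (ContinuousLinearMap.opNorm_comp_le _ _).trans ?_
      have h1 := ContinuousLinearMap.norm_inr_le_one ℝ E E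
      refine (mul_le_of_le_one_right (norm_nonneg _) h1).trans (hl.trans (le_of_eq ?_))
      simp [Prod.norm_def])
    (x := 0) (y := z) (by simpa using h0) (by simpa using hz)
  have e1 : f (y, 0) = y := (hb₂ (by simpa using hy.trans_le (min_le_right _ _))).1
  have e2 : f (0, z) = z := (hb₂ (by simpa using hz.trans_le (min_le_right _ _))).2
  have e3 : f (0, 0) = 0 := (hb₂ (y := 0) (by simpa using hε₂)).1
  rw [sub_zero] at this
  refine le_trans (le_of_eq ?_) this
  simp only [e1, e2, e3]
  congr 1
  abel

/-- The partial derivative at the diagonal of a `C^2` map with `f (0, z) = z` near `0` is Lipschitz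
close to the identity. -/
lemma exists_fderiv_comp_inr_bound {f : E × E → E} (hf : ContDiffAt ℝ 2 f 0)
    (h₂ : ∀ᶠ z in 𝓝 (0 : E), f (0, z) = z) :
    ∃ C : ℝ, 0 ≤ C ∧ ∃ ρ > 0, (∀ y, ‖y‖ < ρ → DifferentiableAt ℝ f (y, y)) ∧
      ContinuousOn (fun y ↦ (fderiv ℝ f (y, y)).comp (ContinuousLinearMap.inr ℝ E E))
        (Metric.ball 0 ρ) ∧
      ∀ y, ‖y‖ < ρ → ‖(fderiv ℝ f (y, y)).comp (ContinuousLinearMap.inr ℝ E E) -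
        ContinuousLinearMap.id ℝ E‖ ≤ C * ‖y‖ := by
  obtain ⟨K, t, ht, hK⟩ :=
    (hf.fderiv_right (m := 1) (by norm_num)).exists_lipschitzOnWith
  have hd : ∀ᶠ p in 𝓝 (0 : E × E), DifferentiableAt ℝ f p :=
    (hf.eventually (by simp)).mono fun p hp ↦ hp.differentiableAt two_ne_zero
  obtain ⟨ε, hε, hb⟩ := Metric.eventually_nhds_iff.1 (hd.and ht)
  have hyy : ∀ y : E, ‖y‖ < ε → dist (y, y) 0 < ε := fun y hy ↦ by
    rw [dist_zero_right, Prod.norm_mk]; exact max_lt hy hy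
  refine ⟨K, K.2, ε, hε, fun y hy ↦ (hb (hyy y hy)).1, ?_, fun y hy ↦ ?_⟩
  · have h1 : ContinuousOn (fun y : E ↦ fderiv ℝ f (y, y)) (Metric.ball 0 ε) :=
      hK.continuousOn.comp (by fun_prop) fun y hy ↦ (hb (hyy y (by simpa using hy))).2
    exact h1.clm_comp continuousOn_const
  · have hid : (fderiv ℝ f (0, 0)).comp (ContinuousLinearMap.inr ℝ E E) =
        ContinuousLinearMap.id ℝ E := by
      have h := (hb (hyy 0 (by simpa using hε))).1.hasFDerivAt
      have h' : HasFDerivAt (fun z : E ↦ f (0, z)) _ 0 :=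
        h.comp 0 (hasFDerivAt_prodMk_right (0 : E) (0 : E))
      exact h'.unique ((hasFDerivAt_id (0 : E)).congr_of_eventuallyEq h₂)
    rw [← hid, ← ContinuousLinearMap.sub_comp]
    have hl := hK.norm_sub_le (hb (hyy y hy)).2 (hb (hyy 0 (by simpa using hε))).2
    refine (ContinuousLinearMap.opNorm_comp_le _ _).trans ?_
    have h1 := ContinuousLinearMap.norm_inr_le_one ℝ E E
    refine (mul_le_of_le_one_right (norm_nonneg _) h1).trans (hl.trans (le_of_eq ?_))
    simp [Prod.norm_def]

end Calculus

section Chart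

variable {E : Type*} [NormedAddCommGroup E] [NormedSpace ℝ E]
  {H : Type*} [TopologicalSpace H] (I : ModelWithCorners ℝ E H)
  {G : Type*} [TopologicalSpace G] [ChartedSpace H G] [Group G]

/-- The coordinates of the preferred chart at the identity, centered at `0`. -/
def chartLog (g : G) : E := extChartAt I (1 : G) g - extChartAt I (1 : G) 1

variable (G) in
/-- The inverse of the chart `chartLog`. -/
def chartExp (y : E) : G := (extChartAt I (1 : G)).symm (y + extChartAt I (1 : G) 1)

variable (G) in
/-- The coordinate ball of radius `ρ` around the identity. -/
def chartBall (ρ : ℝ) : Set G := {g | g ∈ (extChartAt I (1 : G)).source ∧ ‖chartLog I g‖ < ρ}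

@[simp] lemma chartLog_one : chartLog I (1 : G) = 0 := by simp [chartLog]

@[simp] lemma chartExp_zero : chartExp I G 0 = 1 := by simp [chartExp]

variable {I} in
lemma chartExp_chartLog {g : G} (hg : g ∈ (extChartAt I (1 : G)).source) :
    chartExp I G (chartLog I g) = g := by
  rw [chartExp, chartLog, sub_add_cancel, (extChartAt I (1 : G)).left_inv hg]

lemma one_mem_chartBall {ρ : ℝ} (hρ : 0 < ρ) : (1 : G) ∈ chartBall I G ρ := by
  simp [chartBall, hρ]

lemma continuousOn_chartLog : ContinuousOn (chartLog I : G → E) (extChartAt I (1 : G)).source :=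
  (continuousOn_extChartAt _).sub continuousOn_const

lemma isOpen_chartBall (ρ : ℝ) : IsOpen (chartBall I G ρ) := by
  have : chartBall I G ρ = (extChartAt I (1 : G)).source ∩ (chartLog I) ⁻¹' Metric.ball 0 ρ := by
    ext; simp [chartBall]
  rw [this]
  exact (continuousOn_chartLog I).isOpen_inter_preimage (isOpen_extChartAt_source _)
    Metric.isOpen_ball

variable {I} in
lemma chartLog_chartExp {y : E} (hy : y + extChartAt I (1 : G) 1 ∈ (extChartAt I (1 : G)).target) :
    chartLog I (chartExp I G y) = y := by
  rw [chartLog, chartExp, (extChartAt I (1 : G)).right_inv hy, add_sub_cancel_right]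

variable {I} in
lemma chartExp_mem_source {y : E}
    (hy : y + extChartAt I (1 : G) 1 ∈ (extChartAt I (1 : G)).target) :
    chartExp I G y ∈ (extChartAt I (1 : G)).source := (extChartAt I (1 : G)).map_target hy

variable (G) in
lemma eventually_add_mem_target [I.Boundaryless] :
    ∀ᶠ y in 𝓝 (0 : E), y + extChartAt I (1 : G) 1 ∈ (extChartAt I (1 : G)).target := by
  have h : Tendsto (fun y : E ↦ y + extChartAt I (1 : G) 1) (𝓝 0) (𝓝 (extChartAt I (1 : G) 1)) := by
    have : Continuous fun y : E ↦ y + extChartAt I (1 : G) 1 := by fun_prop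
    simpa using this.tendsto 0
  exact h (extChartAt_target_mem_nhds (1 : G))

variable [LieGroup I ∞ G]

lemma contMDiffAt_chartLog {g : G} (hg : g ∈ (extChartAt I (1 : G)).source) :
    ContMDiffAt I 𝓘(ℝ, E) ∞ (chartLog I) g :=
  (contMDiffAt_extChartAt' (by simpa using hg)).sub contMDiffAt_const

variable {I} in
lemma contMDiffAt_chartExp [I.Boundaryless] {y : E}
    (hy : y + extChartAt I (1 : G) 1 ∈ (extChartAt I (1 : G)).target) :
    ContMDiffAt 𝓘(ℝ, E) I ∞ (chartExp I G) y := by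
  have h1 : ContMDiffAt 𝓘(ℝ, E) I ∞ (extChartAt I (1 : G)).symm (y + extChartAt I (1 : G) 1) :=
    (contMDiffOn_extChartAt_symm (1 : G)).contMDiffAt
      ((isOpen_extChartAt_target (1 : G)).mem_nhds hy)
  have h2 : ContMDiffAt 𝓘(ℝ, E) 𝓘(ℝ, E) ∞ (fun y : E ↦ y + extChartAt I (1 : G) 1) y :=
    (contDiff_id.add contDiff_const).contMDiff.contMDiffAt
  exact ContMDiffAt.comp y h1 h2

variable (G) in
lemma contMDiffAt_chartExp_fst [I.Boundaryless] :
    ContMDiffAt 𝓘(ℝ, E × E) I ∞ (fun p : E × E ↦ chartExp I G p.1) 0 :=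
  ContMDiffAt.comp (g := chartExp I G) (f := Prod.fst) (0 : E × E)
    (contMDiffAt_chartExp (eventually_add_mem_target I G).self_of_nhds)
    contDiff_fst.contMDiff.contMDiffAt

variable (G) in
lemma contMDiffAt_chartExp_snd [I.Boundaryless] :
    ContMDiffAt 𝓘(ℝ, E × E) I ∞ (fun p : E × E ↦ chartExp I G p.2) 0 :=
  ContMDiffAt.comp (g := chartExp I G) (f := Prod.snd) (0 : E × E)
    (contMDiffAt_chartExp (eventually_add_mem_target I G).self_of_nhds)
    contDiff_snd.contMDiff.contMDiffAt

variable (G) in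
lemma contDiffAt_chartLog_mul [I.Boundaryless] :
    ContDiffAt ℝ ∞ (fun p : E × E ↦ chartLog I (chartExp I G p.1 * chartExp I G p.2)) 0 := by
  rw [← contMDiffAt_iff_contDiffAt]
  exact ContMDiffAt.comp (g := chartLog I) (f := fun p : E × E ↦ chartExp I G p.1 * chartExp I G p.2)
    (0 : E × E) (contMDiffAt_chartLog I (by simp))
    ((contMDiffAt_chartExp_fst I G).mul (contMDiffAt_chartExp_snd I G))

variable (G) in
lemma contDiffAt_chartLog_inv_mul [I.Boundaryless] :
    ContDiffAt ℝ ∞ (fun p : E × E ↦ chartLog I ((chartExp I G p.1)⁻¹ * chartExp I G p.2)) 0 := by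
  rw [← contMDiffAt_iff_contDiffAt]
  exact ContMDiffAt.comp (g := chartLog I)
    (f := fun p : E × E ↦ (chartExp I G p.1)⁻¹ * chartExp I G p.2)
    (0 : E × E) (contMDiffAt_chartLog I (by simp))
    ((contMDiffAt_chartExp_fst I G).inv.mul (contMDiffAt_chartExp_snd I G))

section Velocity

variable {I} {a b : ℝ} {c : ℝ → G}

lemma hasDerivWithinAt_chartLog_inv_mul {t : ℝ}
    (hc : MDifferentiableWithinAt 𝓘(ℝ, ℝ) I c (Icc a b) t) :
    HasDerivWithinAt (fun t' ↦ chartLog I ((c t)⁻¹ * c t')) (leftVelocity I a b c t) (Icc a b) t := by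
  have h1 : HasMFDerivWithinAt 𝓘(ℝ, ℝ) I (fun t' ↦ (c t)⁻¹ * c t') (Icc a b) t
      ((mfderiv I I (fun h : G ↦ (c t)⁻¹ * h) (c t)).comp
        (mfderivWithin 𝓘(ℝ, ℝ) I c (Icc a b) t)) :=
    HasMFDerivAt.comp_hasMFDerivWithinAt t
      ((contMDiff_mul_left (I := I) (n := ∞) (a := (c t)⁻¹)).mdifferentiable
        (by simp) (c t)).hasMFDerivAt hc.hasMFDerivWithinAt
  have h2 := h1.2
  simp only [writtenInExtChartAt, inv_mul_cancel, extChartAt_model_space_eq_id] at h2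
  let D : ℝ →L[ℝ] E := (mfderiv I I (fun h : G ↦ (c t)⁻¹ * h) (c t)).comp
    (mfderivWithin 𝓘(ℝ, ℝ) I c (Icc a b) t)
  have h3 : HasFDerivWithinAt (fun t' ↦ extChartAt I (1 : G) ((c t)⁻¹ * c t')) D (Icc a b) t := by
    have hset : (PartialEquiv.refl ℝ).symm ⁻¹' Icc a b ∩ range 𝓘(ℝ, ℝ) = Icc a b := by simp
    rw [hset] at h2
    exact h2
  exact (h3.hasDerivWithinAt.sub_const (extChartAt I (1 : G) 1))

lemma leftVelocity_eq_derivWithin {t : ℝ} (hab : a < b) (ht : t ∈ Icc a b)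
    (hc : MDifferentiableWithinAt 𝓘(ℝ, ℝ) I c (Icc a b) t) :
    leftVelocity I a b c t = derivWithin (fun t' ↦ chartLog I ((c t)⁻¹ * c t')) (Icc a b) t :=
  ((hasDerivWithinAt_chartLog_inv_mul hc).derivWithin (uniqueDiffOn_Icc hab t ht)).symm

lemma mdifferentiableWithinAt_const_mul {t : ℝ} (g : G)
    (hc : MDifferentiableWithinAt 𝓘(ℝ, ℝ) I c (Icc a b) t) :
    MDifferentiableWithinAt 𝓘(ℝ, ℝ) I (fun t ↦ g * c t) (Icc a b) t :=
  MDifferentiableAt.comp_mdifferentiableWithinAt t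
    ((contMDiff_mul_left (I := I) (n := ∞) (a := g)).mdifferentiable (by simp) (c t)) hc

/-- The velocity pulled back to the Lie algebra is invariant under left translations. -/
lemma leftVelocity_const_mul {t : ℝ} (hab : a < b) (ht : t ∈ Icc a b) (g : G)
    (hc : MDifferentiableWithinAt 𝓘(ℝ, ℝ) I c (Icc a b) t) :
    leftVelocity I a b (fun t ↦ g * c t) t = leftVelocity I a b c t := by
  rw [leftVelocity_eq_derivWithin hab ht (mdifferentiableWithinAt_const_mul g hc),
    leftVelocity_eq_derivWithin hab ht hc]
  congr 1
  ext t'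
  simp [mul_assoc]

lemma leftVelocity_subinterval {s t τ : ℝ} (has : a ≤ s) (hst : s < t) (htb : t ≤ b)
    (hτ : τ ∈ Icc s t) (hc : MDifferentiableWithinAt 𝓘(ℝ, ℝ) I c (Icc a b) τ) :
    leftVelocity I s t c τ = leftVelocity I a b c τ := by
  have hsub := Icc_subset_Icc has htb
  rw [leftVelocity_eq_derivWithin hst hτ (hc.mono hsub)]
  exact ((hasDerivWithinAt_chartLog_inv_mul hc).mono hsub).derivWithin
    (uniqueDiffOn_Icc hst τ hτ)

lemma differentiableWithinAt_chartLog_comp {s : Set ℝ} {t : ℝ}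
    (hc : MDifferentiableWithinAt 𝓘(ℝ, ℝ) I c s t)
    (ht : c t ∈ (extChartAt I (1 : G)).source) :
    DifferentiableWithinAt ℝ (fun t ↦ chartLog I (c t)) s t := by
  rw [← mdifferentiableWithinAt_iff_differentiableWithinAt]
  exact MDifferentiableAt.comp_mdifferentiableWithinAt t
    ((contMDiffAt_chartLog I ht).mdifferentiableAt (by simp)) hc

lemma contDiffWithinAt_chartLog_comp {s : Set ℝ} {t : ℝ}
    (hc : ContMDiffWithinAt 𝓘(ℝ, ℝ) I 1 c s t)
    (ht : c t ∈ (extChartAt I (1 : G)).source) :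
    ContDiffWithinAt ℝ 1 (fun t ↦ chartLog I (c t)) s t := by
  rw [← contMDiffWithinAt_iff_contDiffWithinAt]
  exact ContMDiffAt.comp_contMDiffWithinAt t
    ((contMDiffAt_chartLog I ht).of_le (by simp)) hc

end Velocity

variable (G) in
/-- Uniform estimates for the chart `chartLog` on the coordinate ball of radius `ρ`. The operator
`A y` expresses the left-invariant velocity of a curve through the point with coordinates `y` in
terms of its coordinate velocity. -/
structure ChartBounds (ρ C : ℝ) (A : E → E →L[ℝ] E) : Prop where
  pos : 0 < ρ
  nonneg : 0 ≤ C
  mul_le_half : C * ρ ≤ 1 / 2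
  mem_target : ∀ y : E, ‖y‖ < ρ → y + extChartAt I (1 : G) 1 ∈ (extChartAt I (1 : G)).target
  mul_mem_source : ∀ g ∈ chartBall I G ρ, ∀ h ∈ chartBall I G ρ,
    g * h ∈ (extChartAt I (1 : G)).source
  norm_mul_le : ∀ g ∈ chartBall I G ρ, ∀ h ∈ chartBall I G ρ,
    ‖chartLog I (g * h) - chartLog I g - chartLog I h‖ ≤ C * ‖chartLog I g‖ * ‖chartLog I h‖
  continuousOn : ContinuousOn A (Metric.ball 0 ρ)
  norm_sub_id_le : ∀ y, ‖y‖ < ρ → ‖A y - ContinuousLinearMap.id ℝ E‖ ≤ C * ‖y‖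
  velocity : ∀ (a b : ℝ) (c : ℝ → G) (t : ℝ), a < b → t ∈ Icc a b →
    MDifferentiableWithinAt 𝓘(ℝ, ℝ) I c (Icc a b) t → c t ∈ chartBall I G ρ →
    leftVelocity I a b c t = A (chartLog I (c t)) (derivWithin (fun t ↦ chartLog I (c t)) (Icc a b) t)

variable (G) in
theorem exists_chartBounds [I.Boundaryless] : ∃ ρ C A, ChartBounds I G ρ C A := by
  have htgt := eventually_add_mem_target I G
  set m : E × E → E := fun p ↦ chartLog I (chartExp I G p.1 * chartExp I G p.2) with hm
  set μ : E × E → E := fun p ↦ chartLog I ((chartExp I G p.1)⁻¹ * chartExp I G p.2) with hμ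
  obtain ⟨C₁, hC₁, ρ₁, hρ₁, hb₁⟩ := exists_norm_sub_sub_le (f := m)
    ((contDiffAt_chartLog_mul I G).of_le ENat.LEInfty.out)
    (htgt.mono fun y hy ↦ by simp [hm, chartLog_chartExp hy])
    (htgt.mono fun y hy ↦ by simp [hm, chartLog_chartExp hy])
  obtain ⟨C₂, hC₂, ρ₂, hρ₂, hd, hcont, hb₂⟩ := exists_fderiv_comp_inr_bound (f := μ)
    ((contDiffAt_chartLog_inv_mul I G).of_le ENat.LEInfty.out)
    (htgt.mono fun y hy ↦ by simp [hμ, chartLog_chartExp hy])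
  obtain ⟨ρ₃, hρ₃, hb₃⟩ := Metric.eventually_nhds_iff.1 htgt
  have hsrc : ∀ᶠ p in 𝓝 (0 : E × E),
      chartExp I G p.1 * chartExp I G p.2 ∈ (extChartAt I (1 : G)).source := by
    have h := ((contMDiffAt_chartExp_fst I G).mul (contMDiffAt_chartExp_snd I G)).continuousAt
    refine h.eventually_mem ?_
    simpa using extChartAt_source_mem_nhds (I := I) (1 : G)
  obtain ⟨ρ₄, hρ₄, hb₄⟩ := Metric.eventually_nhds_iff.1 hsrc
  set C := max C₁ C₂
  set ρ := min (min (min ρ₁ ρ₂) (min ρ₃ ρ₄)) (1 / (2 * (C + 1))) with hρdef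
  have hC : 0 ≤ C := hC₁.trans (le_max_left _ _)
  have hρ : 0 < ρ := by positivity
  have l1 : ρ ≤ ρ₁ := by simp [hρdef]
  have l2 : ρ ≤ ρ₂ := by simp [hρdef]
  have l3 : ρ ≤ ρ₃ := by simp [hρdef]
  have l4 : ρ ≤ ρ₄ := by simp [hρdef]
  have l5 : ρ ≤ 1 / (2 * (C + 1)) := min_le_right _ _
  refine ⟨ρ, C, fun y ↦ (fderiv ℝ μ (y, y)).comp (ContinuousLinearMap.inr ℝ E E),
    hρ, hC, ?_, fun y hy ↦ hb₃ (by simpa using hy.trans_le l3), ?_, ?_,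
    hcont.mono (Metric.ball_subset_ball l2), ?_, ?_⟩
  · calc C * ρ ≤ C * (1 / (2 * (C + 1))) := by gcongr
      _ ≤ 1 / 2 := by
        rw [mul_one_div, div_le_div_iff₀ (by positivity) two_pos]
        linarith
  · rintro g ⟨hg, hg'⟩ h ⟨hh, hh'⟩
    have := hb₄ (y := (chartLog I g, chartLog I h)) (by
      rw [dist_zero_right, Prod.norm_mk]
      exact max_lt (hg'.trans_le l4) (hh'.trans_le l4))
    simpa only [chartExp_chartLog hg, chartExp_chartLog hh] using this
  · rintro g ⟨hg, hg'⟩ h ⟨hh, hh'⟩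
    have := hb₁ (chartLog I g) (chartLog I h) (hg'.trans_le l1) (hh'.trans_le l1)
    simp only [hm, chartExp_chartLog hg, chartExp_chartLog hh] at this
    refine this.trans ?_
    gcongr
    exact le_max_left _ _
  · intro y hy
    refine (hb₂ y (hy.trans_le l2)).trans ?_
    gcongr
    exact le_max_right _ _
  · rintro a b c t hab ht hc ⟨hct, hct'⟩
    have hev : ∀ᶠ t' in 𝓝[Icc a b] t, c t' ∈ (extChartAt I (1 : G)).source :=
      hc.continuousWithinAt.eventually_mem ((isOpen_extChartAt_source (1 : G)).mem_nhds hct)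
    have hL := (differentiableWithinAt_chartLog_comp hc hct).hasDerivWithinAt
    have h1 := (hd _ (hct'.trans_le l2)).hasFDerivAt
    have h2 : HasDerivWithinAt (fun t' ↦ (chartLog I (c t), chartLog I (c t')))
        ((0 : E), derivWithin (fun t ↦ chartLog I (c t)) (Icc a b) t) (Icc a b) t :=
      (hasDerivWithinAt_const t (Icc a b) (chartLog I (c t))).prodMk hL
    have h3 := HasFDerivAt.comp_hasDerivWithinAt (l := μ) t h1 h2
    rw [leftVelocity_eq_derivWithin hab ht hc]
    have h4 : HasDerivWithinAt (fun t' ↦ chartLog I ((c t)⁻¹ * c t')) _ (Icc a b) t :=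
      h3.congr_of_eventuallyEq (hev.mono fun t' ht' ↦ ?_) ?_
    · exact h4.derivWithin (uniqueDiffOn_Icc hab t ht)
    · simp [hμ, chartExp_chartLog hct, chartExp_chartLog ht']
    · simp [hμ, chartExp_chartLog hct]

end Chart

section Distance

variable {E : Type*} [NormedAddCommGroup E] [NormedSpace ℝ E]
  {H : Type*} [TopologicalSpace H] (I : ModelWithCorners ℝ E H)
  {G : Type*} [TopologicalSpace G] [ChartedSpace H G] [Group G]
  (N : Seminorm ℝ E) {a b : ℝ} {c : ℝ → G} {g h : G}

variable (G) in
/-- The left-invariant norms are homogeneous. -/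
lemma enormSMulClass_leftInvariantENorm (g : G) :
    letI := leftInvariantENorm I (G := G) N
    ENormSMulClass ℝ (TangentSpace I g) := by
  let := leftInvariantENorm I (G := G) N
  refine ⟨fun k x ↦ ?_⟩
  change ENNReal.ofReal (N (toLieAlgebra I g (k • x))) =
    ‖k‖ₑ * ENNReal.ofReal (N (toLieAlgebra I g x))
  have : toLieAlgebra I g (k • x) = (k • (toLieAlgebra I g x : E) : E) :=
    (mfderiv I I (fun h : G ↦ g⁻¹ * h) g).map_smul k x
  have key : N (toLieAlgebra I g (k • x)) = ‖k‖ * N (toLieAlgebra I g x) :=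
    (congrArg N this).trans (map_smul_eq_mul N k _)
  rw [key, ENNReal.ofReal_mul (norm_nonneg _), ofReal_norm]

lemma leftInvariantEDist_le_lintegral (hab : a ≤ b) (hc : ContMDiffOn 𝓘(ℝ, ℝ) I 1 c (Icc a b)) :
    leftInvariantEDist I (G := G) N (c a) (c b) ≤
      ∫⁻ t in Icc a b, ENNReal.ofReal (N (leftVelocity I a b c t)) := by
  let := leftInvariantENorm I (G := G) N
  have := enormSMulClass_leftInvariantENorm I G N
  refine (Manifold.riemannianEDist_le_pathELength hc rfl rfl hab).trans (le_of_eq ?_)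
  exact Manifold.pathELength_eq_lintegral_mfderivWithin_Icc

lemma exists_lintegral_lt_of_leftInvariantEDist_lt {R : ℝ≥0∞}
    (hR : leftInvariantEDist I (G := G) N g h < R) :
    ∃ c : ℝ → G, c 0 = g ∧ c 1 = h ∧ ContMDiffOn 𝓘(ℝ, ℝ) I 1 c (Icc 0 1) ∧
      ∫⁻ t in Icc 0 1, ENNReal.ofReal (N (leftVelocity I 0 1 c t)) < R := by
  let := leftInvariantENorm I (G := G) N
  obtain ⟨c, h0, h1, hc, hlen⟩ := Manifold.exists_lt_of_riemannianEDist_lt hR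
  rw [Manifold.pathELength_eq_lintegral_mfderivWithin_Icc] at hlen
  exact ⟨c, h0, h1, hc, hlen⟩

lemma leftInvariantEDist_self : leftInvariantEDist I (G := G) N g g = 0 := by
  let := leftInvariantENorm I (G := G) N
  have := enormSMulClass_leftInvariantENorm I G N
  exact Manifold.riemannianEDist_self

lemma leftInvariantEDist_comm :
    leftInvariantEDist I (G := G) N g h = leftInvariantEDist I (G := G) N h g := by
  let := leftInvariantENorm I (G := G) N
  have := enormSMulClass_leftInvariantENorm I G N
  exact Manifold.riemannianEDist_comm

lemma leftInvariantEDist_triangle (g h k : G) :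
    leftInvariantEDist I (G := G) N g k ≤
      leftInvariantEDist I (G := G) N g h + leftInvariantEDist I (G := G) N h k := by
  let := leftInvariantENorm I (G := G) N
  have := enormSMulClass_leftInvariantENorm I G N
  exact Manifold.riemannianEDist_triangle

variable [LieGroup I ∞ G]

lemma contMDiffOn_const_mul {s : Set ℝ} (k : G) (hc : ContMDiffOn 𝓘(ℝ, ℝ) I 1 c s) :
    ContMDiffOn 𝓘(ℝ, ℝ) I 1 (fun t ↦ k * c t) s :=
  ((contMDiff_mul_left (I := I) (n := ∞) (a := k)).of_le (by simp)).comp_contMDiffOn hc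

lemma leftInvariantEDist_mul_le (k : G) :
    leftInvariantEDist I (G := G) N (k * g) (k * h) ≤ leftInvariantEDist I (G := G) N g h := by
  refine le_of_forall_gt fun R hR ↦ ?_
  obtain ⟨c, rfl, rfl, hc, hlen⟩ := exists_lintegral_lt_of_leftInvariantEDist_lt I N hR
  refine (leftInvariantEDist_le_lintegral I N zero_le_one
    (contMDiffOn_const_mul I k hc)).trans_lt (lt_of_eq_of_lt ?_ hlen)
  refine setLIntegral_congr_fun measurableSet_Icc fun t ht ↦ ?_
  simp only [leftVelocity_const_mul zero_lt_one ht k (hc.mdifferentiableOn one_ne_zero t ht)]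

/-- The distance is left-invariant. -/
lemma leftInvariantEDist_eq_inv_mul :
    leftInvariantEDist I (G := G) N g h = leftInvariantEDist I (G := G) N 1 (g⁻¹ * h) := by
  refine le_antisymm ?_ ?_
  · simpa using leftInvariantEDist_mul_le I N (g := 1) (h := g⁻¹ * h) g
  · simpa using leftInvariantEDist_mul_le I N (g := g) (h := h) g⁻¹

end Distance

section Seminorm

variable {E : Type*} [NormedAddCommGroup E] [NormedSpace ℝ E] [FiniteDimensional ℝ E]

lemma continuous_seminorm (N : Seminorm ℝ E) : Continuous N :=
  N.convexOn.locallyLipschitz.continuous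

lemma exists_seminorm_equiv (N : Seminorm ℝ E) (hN : ∀ v, N v = 0 → v = 0) :
    ∃ κ : ℝ, 1 ≤ κ ∧ (∀ v, N v ≤ κ * ‖v‖) ∧ ∀ v, ‖v‖ ≤ κ * N v := by
  have hcont := continuous_seminorm N
  obtain ⟨κ₁, hκ₁, h₁⟩ := Seminorm.bound_of_continuous_normedSpace N hcont
  obtain ⟨κ₂, hκ₂, h₂⟩ : ∃ κ₂ : ℝ, 0 < κ₂ ∧ ∀ v, ‖v‖ ≤ κ₂ * N v := by
    rcases subsingleton_or_nontrivial E with hE | hE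
    · exact ⟨1, one_pos, fun v ↦ by simp [Subsingleton.elim v 0]⟩
    obtain ⟨x, hx, hmin⟩ := (isCompact_sphere (0 : E) 1).exists_isMinOn
      (NormedSpace.sphere_nonempty.2 zero_le_one) hcont.continuousOn
    have hx1 : ‖x‖ = 1 := by simpa using hx
    have hNx : 0 < N x := (apply_nonneg N x).lt_of_ne' fun h ↦ by
      simp [hN x h] at hx1
    refine ⟨(N x)⁻¹, inv_pos.2 hNx, fun v ↦ ?_⟩
    rcases eq_or_ne v 0 with rfl | hv
    · simp
    have hv' : 0 < ‖v‖ := norm_pos_iff.2 hv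
    have := hmin (show ‖v‖⁻¹ • v ∈ Metric.sphere (0 : E) 1 by
      simp [norm_smul, hv'.ne'])
    simp only [Set.mem_ofPred_eq, map_smul_eq_mul, norm_inv, norm_norm] at this
    rw [inv_mul_eq_div, le_div_iff₀ hNx]
    rwa [inv_mul_eq_div, le_div_iff₀ hv', mul_comm] at this
  refine ⟨max 1 (max κ₁ κ₂), le_max_left _ _, fun v ↦ (h₁ v).trans ?_, fun v ↦ (h₂ v).trans ?_⟩
  · gcongr; simp
  · have := apply_nonneg N v; gcongr; simp

lemma exists_dual_eq_seminorm (N : Seminorm ℝ E) (x : E) :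
    ∃ φ : E →L[ℝ] ℝ, φ x = N x ∧ ∀ y, |φ y| ≤ N y := by
  rcases eq_or_ne x 0 with rfl | hx
  · exact ⟨0, by simp, fun y ↦ by simp⟩
  obtain ⟨φ, h1, h2⟩ := exists_extension_of_le_sublinear
    (LinearPMap.mkSpanSingleton x (N x) hx) N
    (fun k hk y ↦ by simp [map_smul_eq_mul, abs_of_pos hk]) (map_add_le_add N) (by
      rintro ⟨y, hy⟩
      obtain ⟨k, rfl⟩ := Submodule.mem_span_singleton.1 hy
      have h3 : LinearPMap.mkSpanSingleton (σ := RingHom.id ℝ) x (N x) hx ⟨k • x, hy⟩ = k * N x :=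
        LinearPMap.mkSpanSingleton'_apply _ _ _ _ _
      rw [h3, map_smul_eq_mul]
      exact mul_le_mul_of_nonneg_right (le_abs_self k) (apply_nonneg N x))
  refine ⟨LinearMap.toContinuousLinearMap φ, ?_, fun y ↦ N.abs_le_of_le h2 y⟩
  have := h1 ⟨x, Submodule.mem_span_singleton_self x⟩
  simp only [LinearMap.coe_toContinuousLinearMap'] at this ⊢
  rw [this]
  exact LinearPMap.mkSpanSingleton'_apply_self _ _ _ _

/-- The triangle inequality for integrals, for an arbitrary seminorm in finite dimension. -/
lemma ofReal_seminorm_integral_le (N : Seminorm ℝ E) {f : ℝ → E} {a b : ℝ} (hab : a ≤ b)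
    (hf : ContinuousOn f (Icc a b)) :
    ENNReal.ofReal (N (∫ t in a..b, f t)) ≤ ∫⁻ t in Icc a b, ENNReal.ofReal (N (f t)) := by
  obtain ⟨φ, h1, h2⟩ := exists_dual_eq_seminorm N (∫ t in a..b, f t)
  have hint : IntervalIntegrable f volume a b := (hf.mono (by simp [hab])).intervalIntegrable
  rw [← h1, ← φ.intervalIntegral_comp_comm hint, intervalIntegral.integral_of_le hab,
    restrict_Ioc_eq_restrict_Icc]
  refine (ENNReal.ofReal_le_ofReal (le_abs_self _)).trans ?_
  rw [← Real.norm_eq_abs, ofReal_norm]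
  refine (enorm_integral_le_lintegral_enorm _).trans (lintegral_mono fun t ↦ ?_)
  rw [← ofReal_norm, Real.norm_eq_abs]
  exact ENNReal.ofReal_le_ofReal (h2 _)

end Seminorm

/-- A continuous curve in a topological group is uniformly continuous on compact intervals for the
left uniformity. -/
lemma exists_inv_mul_mem {G : Type*} [TopologicalSpace G] [Group G] [IsTopologicalGroup G]
    {a b : ℝ} (hab : a ≤ b) {c : ℝ → G} (hc : ContinuousOn c (Icc a b)) {U : Set G}
    (hU : IsOpen U) (h1 : (1 : G) ∈ U) :
    ∃ h > 0, ∀ s ∈ Icc a b, ∀ t ∈ Icc a b, |t - s| ≤ h → (c s)⁻¹ * c t ∈ U := by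
  set c' : ℝ → G := IccExtend hab ((Icc a b).domRestrict c)
  have hc' : Continuous c' := hc.domRestrict.Icc_extend'
  have hcc : ∀ t ∈ Icc a b, c' t = c t := fun t ht ↦ IccExtend_of_mem hab _ ht
  have hcomp : IsCompact ((fun t : ℝ ↦ (t, t)) '' Icc a b) :=
    isCompact_Icc.image (by fun_prop)
  have hopen : IsOpen ((fun p : ℝ × ℝ ↦ (c' p.1)⁻¹ * c' p.2) ⁻¹' U) := hU.preimage (by fun_prop)
  obtain ⟨δ, hδ, hsub⟩ := hcomp.exists_thickening_subset_open hopen (by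
    rintro _ ⟨t, -, rfl⟩
    simpa using h1)
  refine ⟨δ / 2, by positivity, fun s hs t ht hst ↦ ?_⟩
  have : (s, t) ∈ Metric.thickening δ ((fun t : ℝ ↦ (t, t)) '' Icc a b) := by
    rw [Metric.mem_thickening_iff]
    refine ⟨(s, s), ⟨s, hs, rfl⟩, ?_⟩
    simp only [Prod.dist_eq, dist_self, Real.dist_eq]
    exact max_lt hδ (by linarith)
  have h := hsub this
  simpa [hcc s hs, hcc t ht] using h

section Comparison

variable {E : Type*} [NormedAddCommGroup E] [NormedSpace ℝ E]
  {H : Type*} [TopologicalSpace H] {I : ModelWithCorners ℝ E H}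
  {G : Type*} [TopologicalSpace G] [ChartedSpace H G] [Group G]
  {ρ C : ℝ} {A : E → E →L[ℝ] E} {N : Seminorm ℝ E} {κ : ℝ}

lemma chartBall_mono {σ : ℝ} (h : σ ≤ ρ) : chartBall I G σ ⊆ chartBall I G ρ :=
  fun _ hg ↦ ⟨hg.1, hg.2.trans_le h⟩

lemma ChartBounds.norm_sub_apply_le (hB : ChartBounds I G ρ C A) {y : E} (hy : ‖y‖ < ρ) (u : E) :
    ‖A y u - u‖ ≤ C * ‖y‖ * ‖u‖ := by
  have := (A y - ContinuousLinearMap.id ℝ E).le_of_opNorm_le (hB.norm_sub_id_le y hy) u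
  simpa using this

lemma ChartBounds.norm_sub_apply_le' (hB : ChartBounds I G ρ C A) {y : E} (hy : ‖y‖ < ρ) (u : E) :
    ‖u - A y u‖ ≤ 2 * C * ‖y‖ * ‖A y u‖ := by
  have h1 := hB.norm_sub_apply_le hy u
  have h2 : C * ‖y‖ ≤ 1 / 2 :=
    (mul_le_mul_of_nonneg_left hy.le hB.nonneg).trans hB.mul_le_half
  have h3 : ‖u‖ ≤ 2 * ‖A y u‖ := by
    have h4 : ‖u‖ ≤ ‖A y u‖ + ‖A y u - u‖ := by
      calc ‖u‖ = ‖A y u - (A y u - u)‖ := by congr 1; abel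
        _ ≤ _ := norm_sub_le _ _
    have h5 := mul_le_mul_of_nonneg_right h2 (norm_nonneg u)
    linarith
  rw [norm_sub_rev]
  calc _ ≤ C * ‖y‖ * ‖u‖ := h1
    _ ≤ C * ‖y‖ * (2 * ‖A y u‖) := by
      have := hB.nonneg
      gcongr
    _ = _ := by ring

variable (I) in
/-- The left velocity, as a vector of the model space. -/
def modelVelocity (a b : ℝ) (c : ℝ → G) (t : ℝ) : E := leftVelocity I a b c t

variable [LieGroup I ∞ G]

/-- The left velocity of a `C^1` curve is continuous. -/
lemma continuousOn_modelVelocity (hB : ChartBounds I G ρ C A) {a b : ℝ} (hab : a < b) {c : ℝ → G}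
    (hc : ContMDiffOn 𝓘(ℝ, ℝ) I 1 c (Icc a b)) :
    ContinuousOn (modelVelocity I a b c) (Icc a b) := by
  intro t ht
  set q : ℝ → G := fun τ ↦ (c t)⁻¹ * c τ with hq
  have hq1 : q t = 1 := by simp [hq]
  have hqc : ContMDiffOn 𝓘(ℝ, ℝ) I 1 q (Icc a b) := contMDiffOn_const_mul I _ hc
  have hqt : q t ∈ (extChartAt I (1 : G)).source := by simp [hq1]
  have hev : ∀ᶠ τ in 𝓝[Icc a b] t, q τ ∈ chartBall I G ρ :=
    (hqc t ht).continuousWithinAt.eventually_mem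
      ((isOpen_chartBall I ρ).mem_nhds (hq1 ▸ one_mem_chartBall I hB.pos))
  have hL := contDiffWithinAt_chartLog_comp (hqc t ht) hqt
  have hder : ContinuousWithinAt (fun τ ↦ derivWithin (fun τ ↦ chartLog I (q τ)) (Icc a b) τ)
      (Icc a b) t := by
    have h1 := hL.fderivWithin_right (m := 0) (uniqueDiffOn_Icc hab) (by simp) ht
    exact h1.continuousWithinAt.clm_apply continuousWithinAt_const
  have hA : ContinuousWithinAt (fun τ ↦ A (chartLog I (q τ))) (Icc a b) t := by
    have h1 : ContinuousAt A (chartLog I (q t)) := by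
      rw [hq1, chartLog_one]
      exact hB.continuousOn.continuousAt (Metric.ball_mem_nhds _ hB.pos)
    exact ContinuousAt.comp_continuousWithinAt h1 hL.continuousWithinAt
  have hprod := hA.clm_apply hder
  have heq : ∀ τ ∈ Icc a b, q τ ∈ chartBall I G ρ → modelVelocity I a b c τ =
      A (chartLog I (q τ)) (derivWithin (fun τ ↦ chartLog I (q τ)) (Icc a b) τ) :=
    fun τ hτ hqτ ↦ by
      have h1 := hB.velocity a b q τ hab hτ (hqc.mdifferentiableOn one_ne_zero τ hτ) hqτ
      exact (leftVelocity_const_mul hab hτ _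
        (hc.mdifferentiableOn one_ne_zero τ hτ)).symm.trans h1
  refine hprod.congr_of_eventuallyEq ?_ (heq t ht (hq1 ▸ one_mem_chartBall I hB.pos))
  filter_upwards [hev, self_mem_nhdsWithin] with τ h1 h2 using heq τ h2 h1

lemma contDiffOn_chartLog_comp {a b : ℝ} {c : ℝ → G}
    (hc : ContMDiffOn 𝓘(ℝ, ℝ) I 1 c (Icc a b)) (hV : ∀ t ∈ Icc a b, c t ∈ chartBall I G ρ) :
    ContDiffOn ℝ 1 (fun t ↦ chartLog I (c t)) (Icc a b) :=
  fun t ht ↦ contDiffWithinAt_chartLog_comp (hc t ht) (hV t ht).1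

/-- In the coordinate ball, the coordinate displacement of a curve starting at the identity is
close to the integral of its left velocity. -/
lemma norm_chartLog_sub_integral_le [FiniteDimensional ℝ E] (hB : ChartBounds I G ρ C A) {a b σ M : ℝ}
    (hab : a < b) {c : ℝ → G} (hσ : σ ≤ ρ) (hc : ContMDiffOn 𝓘(ℝ, ℝ) I 1 c (Icc a b))
    (hV : ∀ t ∈ Icc a b, c t ∈ chartBall I G σ) (h1 : c a = 1)
    (hM : ∀ t ∈ Icc a b, ‖modelVelocity I a b c t‖ ≤ M) :
    ‖chartLog I (c b) - ∫ t in a..b, modelVelocity I a b c t‖ ≤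
      2 * C * σ * M * (b - a) := by
  have hL := contDiffOn_chartLog_comp hc hV
  have hftc := intervalIntegral.integral_derivWithin_Icc_of_contDiffOn_Icc hL hab.le
  have hcd : ContinuousOn (derivWithin (fun t ↦ chartLog I (c t)) (Icc a b)) (Icc a b) :=
    hL.continuousOn_derivWithin (uniqueDiffOn_Icc hab) le_rfl
  have hcv := continuousOn_modelVelocity hB hab hc
  rw [h1, chartLog_one, sub_zero] at hftc
  rw [← hftc, ← intervalIntegral.integral_sub
    (hcd.mono (by simp [hab.le])).intervalIntegrable (hcv.mono (by simp [hab.le])).intervalIntegrable]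
  have := intervalIntegral.norm_integral_le_of_norm_le_const (a := a) (b := b)
    (C := 2 * C * σ * M)
    (f := fun t ↦ derivWithin (fun t ↦ chartLog I (c t)) (Icc a b) t - modelVelocity I a b c t)
    (fun t ht ↦ by
      have ht' : t ∈ Icc a b := Ioc_subset_Icc_self (by simpa [uIoc_of_le hab.le] using ht)
      have hMt := hM t ht'
      have hv : modelVelocity I a b c t = A (chartLog I (c t))
          (derivWithin (fun t ↦ chartLog I (c t)) (Icc a b) t) :=
        hB.velocity a b c t hab ht' (hc.mdifferentiableOn one_ne_zero t ht')
          (chartBall_mono hσ (hV t ht'))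
      rw [hv] at hMt ⊢
      refine (hB.norm_sub_apply_le' ((hV t ht').2.trans_le hσ) _).trans ?_
      have := hB.nonneg
      have := (hV t ht').2.le
      have := (norm_nonneg _).trans this
      gcongr)
  rwa [abs_of_pos (sub_pos.2 hab)] at this

/-- The coordinates of the endpoint of a curve in the coordinate ball are bounded by its length. -/
lemma ofReal_chartLog_le_lintegral [FiniteDimensional ℝ E] (hB : ChartBounds I G ρ C A)
    (hκ : 0 ≤ κ) (hN₁ : ∀ v, N v ≤ κ * ‖v‖) (hN₂ : ∀ v, ‖v‖ ≤ κ * N v) {a b σ : ℝ}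
    (hab : a < b) {c : ℝ → G} (hσ0 : 0 ≤ σ) (hσ : σ ≤ ρ)
    (hc : ContMDiffOn 𝓘(ℝ, ℝ) I 1 c (Icc a b))
    (hV : ∀ t ∈ Icc a b, c t ∈ chartBall I G σ) (h1 : c a = 1) :
    ENNReal.ofReal (N (chartLog I (c b))) ≤ ENNReal.ofReal (1 + 2 * C * κ ^ 2 * σ) *
      ∫⁻ t in Icc a b, ENNReal.ofReal (N (leftVelocity I a b c t)) := by
  have hL := contDiffOn_chartLog_comp hc hV
  have hftc := intervalIntegral.integral_derivWithin_Icc_of_contDiffOn_Icc hL hab.le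
  have hcd : ContinuousOn (derivWithin (fun t ↦ chartLog I (c t)) (Icc a b)) (Icc a b) :=
    hL.continuousOn_derivWithin (uniqueDiffOn_Icc hab) le_rfl
  rw [h1, chartLog_one, sub_zero] at hftc
  rw [← hftc, ← lintegral_const_mul' _ _ ENNReal.ofReal_ne_top]
  refine (ofReal_seminorm_integral_le N hab.le hcd).trans
    (setLIntegral_mono' measurableSet_Icc fun t ht ↦ ?_)
  have hC := hB.nonneg
  rw [← ENNReal.ofReal_mul (by positivity)]
  refine ENNReal.ofReal_le_ofReal ?_
  rw [hB.velocity a b c t hab ht (hc.mdifferentiableOn one_ne_zero t ht)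
    (chartBall_mono hσ (hV t ht))]
  set u := derivWithin (fun t ↦ chartLog I (c t)) (Icc a b) t
  set y := chartLog I (c t)
  have hy : ‖y‖ < σ := (hV t ht).2
  set v : E := A y u with hv
  change N u ≤ (1 + 2 * C * κ ^ 2 * σ) * N v
  have hNv := apply_nonneg N v
  calc N u = N (v + (u - v)) := by congr 1; abel
    _ ≤ N v + N (u - v) := map_add_le_add N _ _
    _ ≤ N v + κ * (2 * C * σ * (κ * N v)) := by
      gcongr
      refine (hN₁ _).trans ?_
      gcongr
      refine (hB.norm_sub_apply_le' (hy.trans_le hσ) u).trans ?_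
      gcongr
      exact hN₂ v
    _ = _ := by ring

/-- The distance to the identity is at most the norm of the coordinates, to first order. -/
lemma leftInvariantEDist_one_le (hB : ChartBounds I G ρ C A) [I.Boundaryless]
    (hκ : 0 ≤ κ) (hN₁ : ∀ v, N v ≤ κ * ‖v‖) {g : G} (hg : g ∈ chartBall I G ρ) :
    leftInvariantEDist I (G := G) N 1 g ≤
      ENNReal.ofReal (N (chartLog I g) + C * κ * ‖chartLog I g‖ ^ 2) := by
  set x : E := chartLog I g with hx
  have hxρ : ‖x‖ < ρ := hg.2
  set c : ℝ → G := fun t ↦ chartExp I G (t • x) with hcdef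
  have hnorm : ∀ t ∈ Icc (0 : ℝ) 1, ‖t • x‖ ≤ ‖x‖ := fun t ht ↦ by
    rw [norm_smul, Real.norm_of_nonneg ht.1]
    exact mul_le_of_le_one_left (norm_nonneg _) ht.2
  have htgt := fun t ht ↦ hB.mem_target (t • x) ((hnorm t ht).trans_lt hxρ)
  have hlog : ∀ t ∈ Icc (0 : ℝ) 1, chartLog I (c t) = t • x := fun t ht ↦
    chartLog_chartExp (htgt t ht)
  have hc : ContMDiffOn 𝓘(ℝ, ℝ) I 1 c (Icc 0 1) := fun t ht ↦ by
    have h1 : ContMDiffAt 𝓘(ℝ, ℝ) 𝓘(ℝ, E) ∞ (fun t : ℝ ↦ t • x) t := by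
      rw [contMDiffAt_iff_contDiffAt]; fun_prop
    exact ((ContMDiffAt.comp (g := chartExp I G) t (contMDiffAt_chartExp (htgt t ht)) h1).of_le
      (by simp)).contMDiffWithinAt
  have hc0 : c 0 = 1 := by simp [hcdef]
  have hc1 : c 1 = g := by simp [hcdef, hx, chartExp_chartLog hg.1]
  have hV : ∀ t ∈ Icc (0 : ℝ) 1, c t ∈ chartBall I G ρ := fun t ht ↦
    ⟨chartExp_mem_source (htgt t ht), by rw [hlog t ht]; exact (hnorm t ht).trans_lt hxρ⟩
  rw [← hc0, ← hc1]
  refine (leftInvariantEDist_le_lintegral I N zero_le_one hc).trans ?_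
  have hbd : ∀ t ∈ Icc (0 : ℝ) 1, ENNReal.ofReal (N (leftVelocity I 0 1 c t)) ≤
      ENNReal.ofReal (N x + C * κ * ‖x‖ ^ 2) := fun t ht ↦ by
    refine ENNReal.ofReal_le_ofReal ?_
    have hd : derivWithin (fun t ↦ chartLog I (c t)) (Icc 0 1) t = x := by
      rw [derivWithin_congr hlog (hlog t ht)]
      have : HasDerivWithinAt (fun t : ℝ ↦ t • x) ((1 : ℝ) • x) (Icc 0 1) t :=
        ((hasDerivAt_id t).smul_const x).hasDerivWithinAt
      rw [this.derivWithin (uniqueDiffOn_Icc zero_lt_one t ht), one_smul]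
    rw [hB.velocity 0 1 c t zero_lt_one ht (hc.mdifferentiableOn one_ne_zero t ht) (hV t ht),
      hd, hlog t ht]
    set v : E := A (t • x) x
    change N v ≤ _
    have hC := hB.nonneg
    calc N v = N (x + (v - x)) := by congr 1; abel
      _ ≤ N x + N (v - x) := map_add_le_add N _ _
      _ ≤ N x + κ * (C * ‖x‖ * ‖x‖) := by
        gcongr
        refine (hN₁ _).trans ?_
        gcongr
        refine (hB.norm_sub_apply_le ((hnorm t ht).trans_lt hxρ) x).trans ?_
        gcongr
        exact hnorm t ht
      _ = _ := by ring
  refine (setLIntegral_mono' measurableSet_Icc hbd).trans (le_of_eq ?_)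
  simp

/-- Points close to the identity lie in the coordinate ball, and the norm of their coordinates is
at most their distance to the identity, to first order. -/
lemma exists_chartLog_le [FiniteDimensional ℝ E] (hB : ChartBounds I G ρ C A)
    (hκ : 1 ≤ κ) (hN₁ : ∀ v, N v ≤ κ * ‖v‖) (hN₂ : ∀ v, ‖v‖ ≤ κ * N v) :
    ∃ δ > 0, ∃ K, 0 ≤ K ∧ ∀ (g : G) (l : ℝ), l ≤ δ →
      leftInvariantEDist I (G := G) N 1 g < ENNReal.ofReal l →
      g ∈ chartBall I G ρ ∧ N (chartLog I g) ≤ l + K * l ^ 2 := by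
  have hC := hB.nonneg
  have hρ := hB.pos
  have hCρ := hB.mul_le_half
  have hκ0 : 0 ≤ κ := by linarith
  set Λ : ℝ := 1 + κ ^ 2 with hΛ
  have hΛ0 : 0 < Λ := by positivity
  refine ⟨ρ / (8 * κ * Λ), by positivity, 4 * C * κ ^ 3 * Λ, by positivity, fun g l hl hd ↦ ?_⟩
  have hl0 : 0 < l := ENNReal.ofReal_pos.1 (bot_le.trans_lt hd)
  have hlρ : κ * Λ * l ≤ ρ / 8 := by
    rw [le_div_iff₀ (by positivity)] at hl
    linarith
  obtain ⟨c, hc0, hc1, hc, hlen⟩ := exists_lintegral_lt_of_leftInvariantEDist_lt I N hd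
  have bound : ∀ σ, 0 ≤ σ → σ ≤ ρ → ∀ t, 0 < t → t ≤ 1 →
      (∀ s ∈ Icc 0 t, c s ∈ chartBall I G σ) →
      N (chartLog I (c t)) ≤ (1 + 2 * C * κ ^ 2 * σ) * l := by
    intro σ hσ0 hσ t ht0 ht1 hV
    have hsub : Icc 0 t ⊆ Icc (0 : ℝ) 1 := Icc_subset_Icc le_rfl ht1
    have h1 := ofReal_chartLog_le_lintegral hB hκ0 hN₁ hN₂ ht0 hσ0 hσ (hc.mono hsub) hV hc0
    have h2 : ∫⁻ s in Icc 0 t, ENNReal.ofReal (N (leftVelocity I 0 t c s)) ≤ ENNReal.ofReal l := by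
      refine le_trans (le_of_eq ?_) ((lintegral_mono_set hsub).trans hlen.le)
      refine setLIntegral_congr_fun measurableSet_Icc fun s hs ↦ ?_
      simp only [leftVelocity_subinterval le_rfl ht0 ht1 hs
        (hc.mdifferentiableOn one_ne_zero s (hsub hs))]
    have h3 := h1.trans (mul_le_mul_right h2 _)
    rw [← ENNReal.ofReal_mul (by positivity)] at h3
    exact (ENNReal.ofReal_le_ofReal_iff (by positivity)).1 h3
  have boundρ : ∀ t, 0 < t → t ≤ 1 → (∀ s ∈ Icc 0 t, c s ∈ chartBall I G ρ) →
      ‖chartLog I (c t)‖ ≤ κ * Λ * l := by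
    intro t ht0 ht1 hV
    have h1 := bound ρ hρ.le le_rfl t ht0 ht1 hV
    calc _ ≤ κ * N (chartLog I (c t)) := hN₂ _
      _ ≤ κ * ((1 + 2 * C * κ ^ 2 * ρ) * l) := by gcongr
      _ ≤ κ * (Λ * l) := by
        gcongr
        nlinarith [sq_nonneg κ]
      _ = _ := by ring
  have htop : IsTopologicalGroup G := topologicalGroup_of_lieGroup I ∞
  obtain ⟨h, hh, hstep⟩ := exists_inv_mul_mem zero_le_one hc.continuousOn
    (isOpen_chartBall I (G := G) (ρ / 4)) (one_mem_chartBall I (by positivity))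
  have hstay : ∀ n : ℕ, ∀ t ∈ Icc (0 : ℝ) 1, t ≤ n * h → c t ∈ chartBall I G ρ := by
    intro n
    induction n with
    | zero =>
      intro t ht hth
      have : t = 0 := le_antisymm (by simpa using hth) ht.1
      rw [this, hc0]
      exact one_mem_chartBall I hρ
    | succ n ih =>
      intro t ht hth
      push_cast at hth
      set s := max 0 (t - h) with hs
      have hs0 : 0 ≤ s := le_max_left _ _
      have hst : s ≤ t := max_le ht.1 (by linarith)
      have hsn : s ≤ n * h := max_le (by positivity) (by linarith)
      have hsI : s ∈ Icc (0 : ℝ) 1 := ⟨hs0, hst.trans ht.2⟩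
      have hcs := ih s hsI hsn
      have hLs : ‖chartLog I (c s)‖ ≤ ρ / 8 := by
        rcases hs0.eq_or_lt with h0 | h0
        · rw [← h0, hc0, chartLog_one, norm_zero]; positivity
        · exact (boundρ s h0 hsI.2 fun τ hτ ↦ ih τ ⟨hτ.1, hτ.2.trans hsI.2⟩
            (hτ.2.trans hsn)).trans hlρ
      have hinc := hstep s hsI t ht (by
        rw [abs_of_nonneg (by linarith)]
        linarith [le_max_right 0 (t - h)])
      have hinc' : (c s)⁻¹ * c t ∈ chartBall I G ρ := chartBall_mono (by linarith) hinc
      have e : c s * ((c s)⁻¹ * c t) = c t := by simp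
      have hm := hB.norm_mul_le _ hcs _ hinc'
      have hsrc := hB.mul_mem_source _ hcs _ hinc'
      rw [e] at hm hsrc
      refine ⟨hsrc, ?_⟩
      set L := chartLog I (c t)
      set L₁ := chartLog I (c s)
      set L₂ := chartLog I ((c s)⁻¹ * c t)
      have hL₂ : ‖L₂‖ < ρ / 4 := hinc.2
      calc ‖L‖ = ‖(L - L₁ - L₂) + L₁ + L₂‖ := by congr 1; abel
        _ ≤ ‖L - L₁ - L₂‖ + ‖L₁‖ + ‖L₂‖ := norm_add₃_le
        _ ≤ C * ρ * (ρ / 4) + ρ / 8 + ρ / 4 := by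
          have : C * ‖L₁‖ * ‖L₂‖ ≤ C * ρ * (ρ / 4) := by
            have := hcs.2.le
            gcongr
          linarith
        _ < ρ := by nlinarith
  have hall : ∀ t ∈ Icc (0 : ℝ) 1, c t ∈ chartBall I G ρ := fun t ht ↦ by
    obtain ⟨n, hn⟩ := exists_nat_ge (1 / h)
    refine hstay n t ht (ht.2.trans ?_)
    rwa [div_le_iff₀ hh] at hn
  have hgρ : g ∈ chartBall I G ρ := hc1 ▸ hall 1 (by simp)
  refine ⟨hgρ, ?_⟩
  have hσ : ∀ t ∈ Icc (0 : ℝ) 1, c t ∈ chartBall I G (2 * (κ * Λ * l)) := fun t ht ↦ by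
    refine ⟨(hall t ht).1, ?_⟩
    have hpos : 0 < κ * Λ * l := by positivity
    rcases ht.1.eq_or_lt with h0 | h0
    · rw [← h0, hc0, chartLog_one, norm_zero]; positivity
    · linarith [boundρ t h0 ht.2 fun s hs ↦ hall s ⟨hs.1, hs.2.trans ht.2⟩]
  have hfin := bound (2 * (κ * Λ * l)) (by positivity) (by linarith) 1 one_pos le_rfl hσ
  rw [hc1] at hfin
  refine hfin.trans (le_of_eq ?_)
  ring

end Comparison

section Main

variable {E : Type*} [NormedAddCommGroup E] [NormedSpace ℝ E]
  {H : Type*} [TopologicalSpace H] {I : ModelWithCorners ℝ E H}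
  {G : Type*} [TopologicalSpace G] [ChartedSpace H G] [Group G]
  {ρ C : ℝ} {A : E → E →L[ℝ] E} {N : Seminorm ℝ E} {κ r a b : ℝ} {γ : ℝ → G}

/-- The extended distance of a seminorm. -/
def seminormEDist (N : Seminorm ℝ E) (u v : E) : ℝ≥0∞ := ENNReal.ofReal (N (u - v))

lemma seminormEDist_self (u : E) : seminormEDist N u u = 0 := by simp [seminormEDist]

lemma seminormEDist_triangle (u v w : E) :
    seminormEDist N u w ≤ seminormEDist N u v + seminormEDist N v w := by
  rw [seminormEDist, seminormEDist, seminormEDist,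
    ← ENNReal.ofReal_add (apply_nonneg N _) (apply_nonneg N _)]
  refine ENNReal.ofReal_le_ofReal ?_
  simpa using map_add_le_add N (u - v) (v - w)

variable (I) in
/-- The left trace, as a curve in the model space. -/
def modelTrace (a b : ℝ) (γ : ℝ → G) (t : ℝ) : E := ∫ s in a..t, modelVelocity I a b γ s

variable [LieGroup I ∞ G]

lemma modelTrace_sub (hB : ChartBounds I G ρ C A) (hab : a < b)
    (hγ : ContMDiffOn 𝓘(ℝ, ℝ) I 1 γ (Icc a b)) {s t : ℝ} (hs : s ∈ Icc a b) (ht : t ∈ Icc a b) :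
    modelTrace I a b γ t - modelTrace I a b γ s = ∫ τ in s..t, modelVelocity I a b γ τ := by
  have hc := continuousOn_modelVelocity hB hab hγ
  have ha : a ∈ Icc a b := ⟨le_rfl, hab.le⟩
  exact intervalIntegral.integral_interval_sub_left
    (hc.mono (uIcc_subset_Icc ha ht)).intervalIntegrable
    (hc.mono (uIcc_subset_Icc ha hs)).intervalIntegrable

lemma exists_norm_modelVelocity_le (hB : ChartBounds I G ρ C A) (hab : a < b)
    (hγ : ContMDiffOn 𝓘(ℝ, ℝ) I 1 γ (Icc a b)) :
    ∃ M, 0 ≤ M ∧ ∀ t ∈ Icc a b, ‖modelVelocity I a b γ t‖ ≤ M := by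
  obtain ⟨M, hM⟩ := isCompact_Icc.exists_bound_of_continuousOn
    (continuousOn_modelVelocity hB hab hγ)
  exact ⟨max M 0, le_max_right _ _, fun t ht ↦ (hM t ht).trans (le_max_left _ _)⟩

/-- The increments of the curve in the chart are uniformly tangent to those of its trace. -/
lemma exists_chartLog_sub_modelTrace_le [FiniteDimensional ℝ E] (hB : ChartBounds I G ρ C A)
    (hab : a < b) (hγ : ContMDiffOn 𝓘(ℝ, ℝ) I 1 γ (Icc a b)) {ε : ℝ} (hε : 0 < ε) :
    ∃ h > 0, ∀ s t, a ≤ s → s ≤ t → t ≤ b → t - s ≤ h → (γ s)⁻¹ * γ t ∈ chartBall I G ρ ∧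
      ‖chartLog I ((γ s)⁻¹ * γ t) - (modelTrace I a b γ t - modelTrace I a b γ s)‖ ≤
        ε * (t - s) := by
  obtain ⟨M, hM0, hM⟩ := exists_norm_modelVelocity_le hB hab hγ
  have hC := hB.nonneg
  have hρ := hB.pos
  set σ := min ρ (ε / (2 * C * M + 1)) with hσdef
  have hσ : 0 < σ := by positivity
  have htop : IsTopologicalGroup G := topologicalGroup_of_lieGroup I ∞
  obtain ⟨h, hh, hstep⟩ := exists_inv_mul_mem hab.le hγ.continuousOn
    (isOpen_chartBall I (G := G) σ) (one_mem_chartBall I hσ)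
  refine ⟨h, hh, fun s t has hst htb hsth ↦ ?_⟩
  have hsI : s ∈ Icc a b := ⟨has, hst.trans htb⟩
  have htI : t ∈ Icc a b := ⟨has.trans hst, htb⟩
  have hV : ∀ τ ∈ Icc s t, (γ s)⁻¹ * γ τ ∈ chartBall I G σ := fun τ hτ ↦
    hstep s hsI τ ⟨has.trans hτ.1, hτ.2.trans htb⟩
      (by rw [abs_of_nonneg (by linarith [hτ.1])]; linarith [hτ.2])
  refine ⟨chartBall_mono (min_le_left _ _) (hV t ⟨hst, le_rfl⟩), ?_⟩
  rcases hst.eq_or_lt with rfl | hst'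
  · simp
  have hsub : Icc s t ⊆ Icc a b := Icc_subset_Icc has htb
  have hvel : ∀ τ ∈ Icc s t,
      modelVelocity I s t (fun τ ↦ (γ s)⁻¹ * γ τ) τ = modelVelocity I a b γ τ := fun τ hτ ↦ by
    have hd := hγ.mdifferentiableOn one_ne_zero τ (hsub hτ)
    exact (leftVelocity_const_mul hst' hτ _ (hd.mono hsub)).trans
      (leftVelocity_subinterval has hst' htb hτ hd)
  have key := norm_chartLog_sub_integral_le hB hst' (min_le_left _ _)
    (contMDiffOn_const_mul I (γ s)⁻¹ (hγ.mono hsub)) hV (by simp)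
    (fun τ hτ ↦ (hvel τ hτ).symm ▸ hM τ (hsub hτ))
  rw [intervalIntegral.integral_congr (g := modelVelocity I a b γ)
    (fun τ hτ ↦ hvel τ (by rwa [uIcc_of_le hst] at hτ)), ← modelTrace_sub hB hab hγ hsI htI] at key
  refine key.trans ?_
  have : 0 ≤ t - s := by linarith
  gcongr
  calc 2 * C * σ * M = (2 * C * M) * σ := by ring
    _ ≤ (2 * C * M + 1) * (ε / (2 * C * M + 1)) := by
      gcongr
      · linarith
      · exact min_le_right _ _
    _ = ε := by field_simp

/-- The sewing estimate along a curve. -/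
lemma chartLog_sub_modelTrace_le [FiniteDimensional ℝ E] (hB : ChartBounds I G ρ C A)
    (hab : a < b) (hγ : ContMDiffOn 𝓘(ℝ, ℝ) I 1 γ (Icc a b)) {θ B w₀ ε s t : ℝ} (hε : 0 < ε)
    (has : a ≤ s) (hst : s ≤ t) (htb : t ≤ b) (hBn : 0 ≤ B) (hθ : 1 < θ)
    (hw₁ : C * B * w₀ ^ (θ / 2) ≤ 1) (hw₂ : 7 * B * w₀ ^ (θ / 2) < ρ)
    {Q : ℝ → ℝ → ℝ} (hQ0 : ∀ u v, 0 ≤ Q u v)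
    (hQ : ∀ u v w, s ≤ u → u ≤ v → v ≤ w → w ≤ t → Q u v + Q v w ≤ Q u w)
    (hQle : ∀ u v, s ≤ u → u ≤ v → v ≤ t → Q u v ≤ w₀)
    (hsmall : ∀ u v, s ≤ u → u ≤ v → v ≤ t → (γ u)⁻¹ * γ v ∈ chartBall I G ρ →
      ‖chartLog I ((γ u)⁻¹ * γ v) - (modelTrace I a b γ v - modelTrace I a b γ u)‖ ≤
        sewingConst θ B C * Q u v ^ θ + ε * (v - u) →
      ‖chartLog I ((γ u)⁻¹ * γ v)‖ ≤ B * Q u v ^ (θ / 2)) :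
    (γ s)⁻¹ * γ t ∈ chartBall I G ρ ∧
      ‖chartLog I ((γ s)⁻¹ * γ t) - (modelTrace I a b γ t - modelTrace I a b γ s)‖ ≤
        sewingConst θ B C * Q s t ^ θ + ε * (t - s) := by
  obtain ⟨h, hh, hstep⟩ := exists_chartLog_sub_modelTrace_le hB hab hγ hε
  obtain ⟨n, hn⟩ := exists_grid_eq (a := s) (b := t) hh
  set p := grid s t h
  have hmono : Monotone p := grid_mono hh.le
  have hp : ∀ i, p i ∈ Icc s t := grid_mem hh.le hst
  have hp0 : p 0 = s := grid_zero hst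
  have hst' : ∀ i, _ := fun i ↦ hstep (p i) (p (i + 1)) (has.trans (hp i).1) (hmono i.le_succ)
    ((hp _).2.trans htb) (grid_succ_sub_le hh.le i)
  have key := sewing_estimate (L := chartLog I) (V := chartBall I G ρ) (C := C) (ρ := ρ) (A := B)
    (θ := θ) (w₀ := w₀) hB.nonneg hBn hθ (one_mem_chartBall I hB.pos) (chartLog_one I)
    hB.norm_mul_le (fun g hg k hk hgk ↦ ⟨hB.mul_mem_source g hg k hk, hgk⟩) hw₁ hw₂
    (g := fun i ↦ γ (p i)) (x := fun i ↦ modelTrace I a b γ (p i)) (e := fun i ↦ ε * p i)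
    (Ω := fun i j ↦ Q (p i) (p j)) (fun i j ↦ hQ0 _ _)
    (fun i j k hij hjk ↦ hQ _ _ _ (hp i).1 (hmono hij) (hmono hjk) (hp k).2)
    (fun i j hij ↦ hQle _ _ (hp i).1 (hmono hij) (hp j).2)
    (fun i j hij hV hD ↦ hsmall _ _ (hp i).1 (hmono hij) (hp j).2 hV (by rwa [mul_sub]))
    (fun i ↦ (hst' i).1) (fun i ↦ by rw [← mul_sub]; exact (hst' i).2) n 0
  simp only [zero_add, hp0, hn] at key
  rwa [← mul_sub] at key

/-- On small intervals, the variation of the trace is small. -/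
lemma exists_rVariation_modelTrace_le (hB : ChartBounds I G ρ C A)
    (hκ : 0 ≤ κ) (hN₁ : ∀ v, N v ≤ κ * ‖v‖) (hr1 : 1 ≤ r) (hab : a < b)
    (hγ : ContMDiffOn 𝓘(ℝ, ℝ) I 1 γ (Icc a b)) :
    ∃ M, 0 ≤ M ∧ ∀ s t, a ≤ s → s ≤ t → t ≤ b →
      rVariation (seminormEDist N) r s t (modelTrace I a b γ) ≤ ENNReal.ofReal (M * (t - s)) := by
  obtain ⟨M, hM0, hM⟩ := exists_norm_modelVelocity_le hB hab hγ
  refine ⟨κ * M, by positivity, fun s t has hst htb ↦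
    rVariation_le_of_lipschitz seminormEDist_self hr1 hst (by positivity) fun u w h1 h2 h3 ↦ ?_⟩
  refine ENNReal.ofReal_le_ofReal ?_
  rw [modelTrace_sub hB hab hγ ⟨by linarith, by linarith⟩ ⟨by linarith, by linarith⟩, mul_assoc]
  refine (hN₁ _).trans ?_
  gcongr
  have := intervalIntegral.norm_integral_le_of_norm_le_const (a := u) (b := w) (C := M)
    (f := modelVelocity I a b γ) (fun τ hτ ↦ by
      rw [uIoc_of_le h2] at hτ
      exact hM τ ⟨by linarith [hτ.1], by linarith [hτ.2]⟩)
  rwa [abs_of_nonneg (by linarith)] at this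

end Main

section ToReal

variable {X : Type*} {d : X → X → ℝ≥0∞} {r s t u v w : ℝ} {c : ℝ → X}

lemma toReal_powVariation_add_le (hfin : powVariation d r s t c ≠ ⊤) (hsu : s ≤ u) (huv : u ≤ v)
    (hvw : v ≤ w) (hwt : w ≤ t) :
    (powVariation d r u v c).toReal + (powVariation d r v w c).toReal ≤
      (powVariation d r u w c).toReal := by
  have h := powVariation_add_le (d := d) (r := r) (c := c) huv hvw
  have hf : powVariation d r u w c ≠ ⊤ := ne_top_of_le_ne_top hfin (powVariation_mono hsu hwt)
  rw [← ENNReal.toReal_add (ne_top_of_le_ne_top hf (le_self_add.trans h))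
    (ne_top_of_le_ne_top hf (le_add_self.trans h))]
  exact ENNReal.toReal_mono hf h

lemma toReal_powVariation_mono (hfin : powVariation d r s t c ≠ ⊤) (hsu : s ≤ u) (hvt : v ≤ t) :
    (powVariation d r u v c).toReal ≤ (powVariation d r s t c).toReal :=
  ENNReal.toReal_mono hfin (powVariation_mono hsu hvt)

lemma edist_le_ofReal_powVariation (hr : 0 < r) (hfin : powVariation d r u v c ≠ ⊤)
    (huv : u ≤ v) :
    d (c v) (c u) ≤ ENNReal.ofReal ((powVariation d r u v c).toReal ^ (1 / r)) := by
  rw [← ENNReal.ofReal_rpow_of_nonneg ENNReal.toReal_nonneg (by positivity),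
    ENNReal.ofReal_toReal hfin, one_div, ENNReal.le_rpow_inv_iff hr]
  exact rpow_le_powVariation le_rfl huv le_rfl

lemma toReal_powVariation_eq (hd : ∀ x, d x x = 0) (hr : 0 < r) (hst : s ≤ t) :
    (powVariation d r s t c).toReal = (rVariation d r s t c).toReal ^ r := by
  rw [← rVariation_rpow hd hr hst, ENNReal.toReal_rpow]

end ToReal

section Main

variable {E : Type*} [NormedAddCommGroup E] [NormedSpace ℝ E] [FiniteDimensional ℝ E]
  {H : Type*} [TopologicalSpace H] {I : ModelWithCorners ℝ E H}
  {G : Type*} [TopologicalSpace G] [ChartedSpace H G] [Group G] [LieGroup I ∞ G]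
  {ρ C : ℝ} {A : E → E →L[ℝ] E} {N : Seminorm ℝ E} {κ r : ℝ}

/-- Local bound of the distance by the norm of the increment of the trace. -/
lemma exists_leftInvariantEDist_le [I.Boundaryless] (hB : ChartBounds I G ρ C A)
    (hκ : 1 ≤ κ) (hN₁ : ∀ v, N v ≤ κ * ‖v‖) (hN₂ : ∀ v, ‖v‖ ≤ κ * N v)
    (hr1 : 1 ≤ r) (hr2 : r < 2) :
    ∃ δ, 0 < δ ∧ δ ≤ 1 ∧ ∃ K, 0 ≤ K ∧ ∀ (a b : ℝ) (γ : ℝ → G), a < b →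
      ContMDiffOn 𝓘(ℝ, ℝ) I 1 γ (Icc a b) → ∀ s t, a ≤ s → s ≤ t → t ≤ b →
      rVariation (seminormEDist N) r s t (modelTrace I a b γ) ≤ ENNReal.ofReal δ →
      leftInvariantEDist I (G := G) N (γ t) (γ s) ≤
        seminormEDist N (modelTrace I a b γ t) (modelTrace I a b γ s) +
          ENNReal.ofReal K * rVariation (seminormEDist N) r s t (modelTrace I a b γ) ^ 2 := by
  have hC := hB.nonneg
  have hρ := hB.pos
  have hr0 : 0 < r := by linarith
  have hκ0 : 0 ≤ κ := by linarith
  set θ := 2 / r with hθdef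
  have hθ : 1 < θ := by rw [hθdef, lt_div_iff₀ hr0]; linarith
  have hθ2 : θ / 2 = 1 / r := by rw [hθdef]; ring
  set B := κ + 2 with hBdef
  have hB0 : 0 < B := by positivity
  set K₀ := sewingConst θ B C
  have hK₀ : 0 ≤ K₀ := sewingConst_nonneg hθ hC
  set δ₀ := min (min 1 (1 / (C * B + 1))) (min (ρ / (8 * B)) (1 / (K₀ + 1))) with hδ₀
  have hδ₀0 : 0 < δ₀ := by positivity
  have hδ1 : δ₀ ≤ 1 := by simp [hδ₀]
  have hδ2 : C * B * δ₀ ≤ 1 := by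
    have : δ₀ ≤ 1 / (C * B + 1) := by simp [hδ₀]
    rw [le_div_iff₀ (by positivity)] at this
    linarith
  have hδ3 : 7 * B * δ₀ < ρ := by
    have : δ₀ ≤ ρ / (8 * B) := by simp [hδ₀]
    rw [le_div_iff₀ (by positivity)] at this
    nlinarith [mul_pos hB0 hδ₀0]
  have hδ4 : K₀ * δ₀ ≤ 1 := by
    have : δ₀ ≤ 1 / (K₀ + 1) := by simp [hδ₀]
    rw [le_div_iff₀ (by positivity)] at this
    linarith
  set w₀ := δ₀ ^ r with hw₀
  have hw₀θ : w₀ ^ (θ / 2) = δ₀ := by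
    rw [hθ2, hw₀, ← Real.rpow_mul hδ₀0.le, mul_one_div_cancel hr0.ne', Real.rpow_one]
  have hw₀1 : w₀ ≤ 1 := Real.rpow_le_one hδ₀0.le hδ1 hr0.le
  refine ⟨δ₀ / 2, by positivity, by linarith, κ * K₀ + C * κ * (κ + 1) ^ 2, by positivity, ?_⟩
  intro a b γ hab hγ s t has hst htb hV
  set x := modelTrace I a b γ with hx
  set V := rVariation (seminormEDist N) r s t x with hVdef
  set v := V.toReal with hv
  have hVtop : V ≠ ⊤ := ne_top_of_le_ne_top ENNReal.ofReal_ne_top hV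
  have hv0 : 0 ≤ v := ENNReal.toReal_nonneg
  have hvδ : v ≤ δ₀ / 2 := ENNReal.toReal_le_of_le_ofReal (by positivity) hV
  set q : ℝ → ℝ → ℝ := fun u w ↦ (powVariation (seminormEDist N) r u w x).toReal with hq
  have hfin : powVariation (seminormEDist N) r s t x ≠ ⊤ := by
    rw [← rVariation_rpow seminormEDist_self hr0 hst]
    exact ENNReal.rpow_ne_top_of_nonneg hr0.le hVtop
  have hqst : q s t = v ^ r := toReal_powVariation_eq seminormEDist_self hr0 hst
  have hq0 : ∀ u w, 0 ≤ q u w := fun u w ↦ ENNReal.toReal_nonneg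
  have hqlt : q s t < w₀ := by
    rw [hqst]
    exact Real.rpow_lt_rpow hv0 (by linarith) hr0
  have hNq : ∀ u w, s ≤ u → u ≤ w → w ≤ t → N (x w - x u) ≤ q u w ^ (1 / r) := fun u w h1 h2 h3 ↦ by
    have := edist_le_ofReal_powVariation hr0
      (ne_top_of_le_ne_top hfin (powVariation_mono h1 h3)) h2
    exact (ENNReal.ofReal_le_ofReal_iff (Real.rpow_nonneg (hq0 u w) _)).1 this
  have sew : ∀ ε, 0 < ε → q s t + ε * (t - s) ≤ w₀ →
      (γ s)⁻¹ * γ t ∈ chartBall I G ρ ∧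
      ‖chartLog I ((γ s)⁻¹ * γ t) - (x t - x s)‖ ≤
        K₀ * (q s t + ε * |t - s|) ^ θ + ε * (t - s) := by
    intro ε hε hεw
    have hQle : ∀ u w, s ≤ u → u ≤ w → w ≤ t → q u w + ε * |w - u| ≤ w₀ := fun u w h1 h2 h3 ↦ by
      refine le_trans (add_le_add (toReal_powVariation_mono hfin h1 h3) ?_) hεw
      rw [abs_of_nonneg (by linarith)]
      gcongr
    refine chartLog_sub_modelTrace_le hB hab hγ (B := B) (w₀ := w₀)
      (Q := fun u w ↦ q u w + ε * |w - u|) hε has hst htb hB0.le hθ (by rwa [hw₀θ]) (by rwa [hw₀θ])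
      (fun u w ↦ by have := hq0 u w; positivity) ?_ hQle ?_
    · intro u w z h1 h2 h3 h4
      have := toReal_powVariation_add_le hfin h1 h2 h3 h4
      rw [abs_of_nonneg (by linarith), abs_of_nonneg (by linarith), abs_of_nonneg (by linarith)]
      simp only [hq]
      linarith
    · intro u w h1 h2 h3 _ hD
      have hQ0 : 0 ≤ q u w + ε * |w - u| := by have := hq0 u w; positivity
      have hQw := hQle u w h1 h2 h3
      set Q := q u w + ε * |w - u| with hQdef
      have habs : |w - u| = w - u := abs_of_nonneg (by linarith)
      have hQr : Q ^ (1 / r) ≤ δ₀ := by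
        rw [← hw₀θ, hθ2]
        exact Real.rpow_le_rpow hQ0 hQw (by positivity)
      have hQr0 : 0 ≤ Q ^ (1 / r) := Real.rpow_nonneg hQ0 _
      have hN : N (x w - x u) ≤ Q ^ (1 / r) := (hNq u w h1 h2 h3).trans
        (Real.rpow_le_rpow (hq0 u w) (by rw [hQdef]; have := abs_nonneg (w - u); nlinarith)
          (by positivity))
      have hQθ : Q ^ θ = (Q ^ (1 / r)) ^ 2 := by
        rw [← Real.rpow_natCast, ← Real.rpow_mul hQ0]; congr 1; push_cast; rw [hθdef]; ring
      have h5 : K₀ * Q ^ θ ≤ Q ^ (1 / r) := by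
        rw [hQθ]
        calc K₀ * (Q ^ (1 / r)) ^ 2 = K₀ * Q ^ (1 / r) * Q ^ (1 / r) := by ring
          _ ≤ K₀ * δ₀ * Q ^ (1 / r) := by gcongr
          _ ≤ 1 * Q ^ (1 / r) := by gcongr
          _ = _ := one_mul _
      have h6 : ε * (w - u) ≤ Q ^ (1 / r) := by
        calc ε * (w - u) ≤ Q := by rw [hQdef, habs]; linarith [hq0 u w]
          _ = Q ^ (1 : ℝ) := (Real.rpow_one Q).symm
          _ ≤ Q ^ (1 / r) := by
            rcases hQ0.eq_or_lt with h0 | h0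
            · rw [← h0, Real.zero_rpow one_ne_zero]; exact Real.rpow_nonneg le_rfl _
            · exact Real.rpow_le_rpow_of_exponent_ge h0 (hQw.trans hw₀1)
                (by rw [div_le_one hr0]; exact hr1)
      set L := chartLog I ((γ u)⁻¹ * γ w)
      calc ‖L‖ = ‖(L - (x w - x u)) + (x w - x u)‖ := by congr 1; abel
        _ ≤ ‖L - (x w - x u)‖ + ‖x w - x u‖ := norm_add_le _ _
        _ ≤ (K₀ * Q ^ θ + ε * (w - u)) + κ * Q ^ (1 / r) := by
          gcongr
          exact (hN₂ _).trans (by gcongr)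
        _ ≤ B * Q ^ (θ / 2) := by rw [hθ2, hBdef]; linarith
  have hev : ∀ᶠ ε in 𝓝[>] (0 : ℝ), 0 < ε ∧ q s t + ε * (t - s) ≤ w₀ := by
    have h1 : Tendsto (fun ε : ℝ ↦ q s t + ε * (t - s)) (𝓝[>] 0) (𝓝 (q s t)) := by
      have : Continuous fun ε : ℝ ↦ q s t + ε * (t - s) := by fun_prop
      simpa using (this.tendsto 0).mono_left nhdsWithin_le_nhds
    filter_upwards [self_mem_nhdsWithin, h1.eventually (gt_mem_nhds hqlt)] with ε h2 h3
    exact ⟨h2, h3.le⟩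
  obtain ⟨ε, hε, hεw⟩ := hev.exists
  have hmem := (sew ε hε hεw).1
  have hD : ‖chartLog I ((γ s)⁻¹ * γ t) - (x t - x s)‖ ≤ K₀ * v ^ 2 := by
    have h1 : Tendsto (fun ε : ℝ ↦ K₀ * (q s t + ε * |t - s|) ^ θ + ε * (t - s)) (𝓝[>] 0)
        (𝓝 (K₀ * q s t ^ θ)) := by
      have hcr := Real.continuous_rpow_const (q := θ) (by linarith)
      have : Continuous fun ε : ℝ ↦ K₀ * (q s t + ε * |t - s|) ^ θ + ε * (t - s) :=
        (continuous_const.mul (hcr.comp (by fun_prop))).add (by fun_prop)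
      simpa using (this.tendsto 0).mono_left nhdsWithin_le_nhds
    have h2 := ge_of_tendsto h1 (hev.mono fun ε h ↦ (sew ε h.1 h.2).2)
    rwa [hqst, ← Real.rpow_mul hv0, hθdef, mul_div_cancel₀ _ hr0.ne', Real.rpow_two] at h2
  have hXv : N (x t - x s) ≤ v := by
    have := hNq s t le_rfl hst le_rfl
    rwa [hqst, ← Real.rpow_mul hv0, mul_one_div_cancel hr0.ne', Real.rpow_one] at this
  set L := chartLog I ((γ s)⁻¹ * γ t)
  have hLX : L = (L - (x t - x s)) + (x t - x s) := by abel
  have hNL : N L ≤ N (x t - x s) + κ * (K₀ * v ^ 2) := by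
    calc N L = N ((L - (x t - x s)) + (x t - x s)) := by rw [← hLX]
      _ ≤ N (L - (x t - x s)) + N (x t - x s) := map_add_le_add N _ _
      _ ≤ κ * (K₀ * v ^ 2) + N (x t - x s) := by
        gcongr
        exact (hN₁ _).trans (by gcongr)
      _ = _ := add_comm _ _
  have hL : ‖L‖ ≤ (κ + 1) * v := by
    calc ‖L‖ = ‖(L - (x t - x s)) + (x t - x s)‖ := by rw [← hLX]
      _ ≤ ‖L - (x t - x s)‖ + ‖x t - x s‖ := norm_add_le _ _
      _ ≤ K₀ * v ^ 2 + κ * v := by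
        gcongr
        exact (hN₂ _).trans (by gcongr)
      _ ≤ (κ + 1) * v := by
        have : K₀ * v ≤ 1 := le_trans (by gcongr; linarith) hδ4
        nlinarith
  rw [leftInvariantEDist_comm, leftInvariantEDist_eq_inv_mul]
  refine (leftInvariantEDist_one_le hB hκ0 hN₁ hmem).trans ?_
  rw [← ENNReal.ofReal_toReal hVtop, ← hv, seminormEDist, ← ENNReal.ofReal_pow hv0,
    ← ENNReal.ofReal_mul (by positivity), ← ENNReal.ofReal_add (apply_nonneg N _) (by positivity)]
  refine ENNReal.ofReal_le_ofReal ?_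
  calc N L + C * κ * ‖L‖ ^ 2 ≤ (N (x t - x s) + κ * (K₀ * v ^ 2)) +
        C * κ * ((κ + 1) * v) ^ 2 := by gcongr
    _ = _ := by ring

/-- Local bound of the norm of the increment of the trace by the distance. -/
lemma exists_seminormEDist_le (hB : ChartBounds I G ρ C A)
    (hκ : 1 ≤ κ) (hN₁ : ∀ v, N v ≤ κ * ‖v‖) (hN₂ : ∀ v, ‖v‖ ≤ κ * N v)
    (hr1 : 1 ≤ r) (hr2 : r < 2) :
    ∃ δ, 0 < δ ∧ δ ≤ 1 ∧ ∃ K, 0 ≤ K ∧ ∀ (a b : ℝ) (γ : ℝ → G), a < b →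
      ContMDiffOn 𝓘(ℝ, ℝ) I 1 γ (Icc a b) → ∀ s t, a ≤ s → s ≤ t → t ≤ b →
      rVariation (leftInvariantEDist I (G := G) N) r s t γ ≤ ENNReal.ofReal δ →
      seminormEDist N (modelTrace I a b γ t) (modelTrace I a b γ s) ≤
        leftInvariantEDist I (G := G) N (γ t) (γ s) +
          ENNReal.ofReal K * rVariation (leftInvariantEDist I (G := G) N) r s t γ ^ 2 := by
  have hC := hB.nonneg
  have hρ := hB.pos
  have hr0 : 0 < r := by linarith
  have hκ0 : 0 ≤ κ := by linarith
  have hself : ∀ g : G, leftInvariantEDist I (G := G) N g g = 0 := fun g ↦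
    leftInvariantEDist_self I N
  obtain ⟨δ₁, hδ₁, K₁, hK₁, hlog⟩ := exists_chartLog_le (G := G) hB hκ hN₁ hN₂
  have hlog' : ∀ (g h : G) (l : ℝ), 0 ≤ l → l < δ₁ →
      leftInvariantEDist I (G := G) N h g ≤ ENNReal.ofReal l →
      g⁻¹ * h ∈ chartBall I G ρ ∧ N (chartLog I (g⁻¹ * h)) ≤ l + K₁ * l ^ 2 := by
    intro g h l hl0 hl hd
    rw [leftInvariantEDist_comm, leftInvariantEDist_eq_inv_mul] at hd
    have hev : ∀ᶠ l' in 𝓝[>] l, l < l' ∧ l' ≤ δ₁ := by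
      filter_upwards [self_mem_nhdsWithin, mem_nhdsWithin_of_mem_nhds (Iio_mem_nhds hl)]
        with l' h1 h2 using ⟨h1, le_of_lt h2⟩
    have hall : ∀ l', l < l' ∧ l' ≤ δ₁ → g⁻¹ * h ∈ chartBall I G ρ ∧
        N (chartLog I (g⁻¹ * h)) ≤ l' + K₁ * l' ^ 2 := fun l' h' ↦
      hlog _ l' h'.2 (hd.trans_lt
        ((ENNReal.ofReal_lt_ofReal_iff (hl0.trans_lt h'.1)).2 h'.1))
    obtain ⟨l', hl'⟩ := hev.exists
    refine ⟨(hall l' hl').1, ge_of_tendsto ?_ (hev.mono fun l' h' ↦ (hall l' h').2)⟩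
    have : Continuous fun l : ℝ ↦ l + K₁ * l ^ 2 := by fun_prop
    exact (this.tendsto l).mono_left nhdsWithin_le_nhds
  set θ := 2 / r with hθdef
  have hθ : 1 < θ := by rw [hθdef, lt_div_iff₀ hr0]; linarith
  have hθ2 : θ / 2 = 1 / r := by rw [hθdef]; ring
  set B := κ * (1 + K₁) with hBdef
  have hB0 : 0 < B := by positivity
  set K₀ := sewingConst θ B C
  have hK₀ : 0 ≤ K₀ := sewingConst_nonneg hθ hC
  set δ₀ := min (min 1 (1 / (C * B + 1))) (min (ρ / (8 * B)) (δ₁ / 2)) with hδ₀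
  have hδ₀0 : 0 < δ₀ := by positivity
  have hδ1 : δ₀ ≤ 1 := by simp [hδ₀]
  have hδ2 : C * B * δ₀ ≤ 1 := by
    have : δ₀ ≤ 1 / (C * B + 1) := by simp [hδ₀]
    rw [le_div_iff₀ (by positivity)] at this
    linarith
  have hδ3 : 7 * B * δ₀ < ρ := by
    have : δ₀ ≤ ρ / (8 * B) := by simp [hδ₀]
    rw [le_div_iff₀ (by positivity)] at this
    nlinarith [mul_pos hB0 hδ₀0]
  have hδ4 : δ₀ < δ₁ := by
    have : δ₀ ≤ δ₁ / 2 := by simp [hδ₀]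
    linarith
  set w₀ := δ₀ ^ r with hw₀
  have hw₀θ : w₀ ^ (θ / 2) = δ₀ := by
    rw [hθ2, hw₀, ← Real.rpow_mul hδ₀0.le, mul_one_div_cancel hr0.ne', Real.rpow_one]
  refine ⟨δ₀, hδ₀0, hδ1, K₁ + κ * K₀, by positivity, ?_⟩
  intro a b γ hab hγ s t has hst htb hV
  set x := modelTrace I a b γ with hx
  set d := leftInvariantEDist I (G := G) N with hd
  set V := rVariation d r s t γ with hVdef
  set v := V.toReal with hv
  have hVtop : V ≠ ⊤ := ne_top_of_le_ne_top ENNReal.ofReal_ne_top hV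
  have hv0 : 0 ≤ v := ENNReal.toReal_nonneg
  have hvδ : v ≤ δ₀ := ENNReal.toReal_le_of_le_ofReal hδ₀0.le hV
  set q : ℝ → ℝ → ℝ := fun u w ↦ (powVariation d r u w γ).toReal with hq
  have hfin : powVariation d r s t γ ≠ ⊤ := by
    rw [← rVariation_rpow hself hr0 hst]
    exact ENNReal.rpow_ne_top_of_nonneg hr0.le hVtop
  have hqst : q s t = v ^ r := toReal_powVariation_eq hself hr0 hst
  have hq0 : ∀ u w, 0 ≤ q u w := fun u w ↦ ENNReal.toReal_nonneg
  have hqle : ∀ u w, s ≤ u → u ≤ w → w ≤ t → q u w ≤ w₀ := fun u w h1 _ h3 ↦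
    (toReal_powVariation_mono hfin h1 h3).trans
      (hqst.trans_le (Real.rpow_le_rpow hv0 hvδ hr0.le))
  have sew : ∀ ε, 0 < ε → (γ s)⁻¹ * γ t ∈ chartBall I G ρ ∧
      ‖chartLog I ((γ s)⁻¹ * γ t) - (x t - x s)‖ ≤ K₀ * q s t ^ θ + ε * (t - s) := by
    intro ε hε
    refine chartLog_sub_modelTrace_le hB hab hγ (B := B) (w₀ := w₀) (Q := q) hε has hst htb
      hB0.le hθ (by rwa [hw₀θ]) (by rwa [hw₀θ]) hq0
      (fun u w z h1 h2 h3 h4 ↦ toReal_powVariation_add_le hfin h1 h2 h3 h4) hqle ?_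
    intro u w h1 h2 h3 _ _
    set l := q u w ^ (1 / r) with hl
    have hl0 : 0 ≤ l := Real.rpow_nonneg (hq0 u w) _
    have hlδ : l ≤ δ₀ := by
      rw [← hw₀θ, hθ2]
      exact Real.rpow_le_rpow (hq0 u w) (hqle u w h1 h2 h3) (by positivity)
    have h4 := (hlog' (γ u) (γ w) l hl0 (hlδ.trans_lt hδ4) (edist_le_ofReal_powVariation hr0
      (ne_top_of_le_ne_top hfin (powVariation_mono h1 h3)) h2)).2
    rw [hθ2, ← hl]
    calc _ ≤ κ * N (chartLog I ((γ u)⁻¹ * γ w)) := hN₂ _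
      _ ≤ κ * (l + K₁ * l ^ 2) := by gcongr
      _ ≤ κ * (l + K₁ * l) := by
        gcongr
        nlinarith
      _ = B * l := by rw [hBdef]; ring
  have hD : ‖chartLog I ((γ s)⁻¹ * γ t) - (x t - x s)‖ ≤ K₀ * v ^ 2 := by
    have h1 : Tendsto (fun ε : ℝ ↦ K₀ * q s t ^ θ + ε * (t - s)) (𝓝[>] 0)
        (𝓝 (K₀ * q s t ^ θ)) := by
      have : Continuous fun ε : ℝ ↦ K₀ * q s t ^ θ + ε * (t - s) := by fun_prop
      simpa using (this.tendsto 0).mono_left nhdsWithin_le_nhds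
    have h2 := ge_of_tendsto h1 (eventually_mem_nhdsWithin.mono fun ε h ↦ (sew ε h).2)
    rwa [hqst, ← Real.rpow_mul hv0, hθdef, mul_div_cancel₀ _ hr0.ne', Real.rpow_two] at h2
  have hdV : d (γ t) (γ s) ≤ V := edist_le_rVariation hself hr0 le_rfl hst le_rfl
  set l := (d (γ t) (γ s)).toReal with hl
  have hdtop : d (γ t) (γ s) ≠ ⊤ := ne_top_of_le_ne_top hVtop hdV
  have hl0 : 0 ≤ l := ENNReal.toReal_nonneg
  have hlv : l ≤ v := ENNReal.toReal_mono hVtop hdV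
  have hNL := (hlog' (γ s) (γ t) l hl0 (by linarith) (by rw [hl, ENNReal.ofReal_toReal hdtop])).2
  rw [← ENNReal.ofReal_toReal hVtop, ← ENNReal.ofReal_toReal hdtop, ← hv, ← hl, seminormEDist,
    ← ENNReal.ofReal_pow hv0, ← ENNReal.ofReal_mul (by positivity),
    ← ENNReal.ofReal_add hl0 (by positivity)]
  refine ENNReal.ofReal_le_ofReal ?_
  set L := chartLog I ((γ s)⁻¹ * γ t)
  have hX : x t - x s = L - (L - (x t - x s)) := by abel
  calc N (x t - x s) = N (L - (L - (x t - x s))) := by rw [← hX]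
    _ ≤ N L + N (L - (x t - x s)) := map_sub_le_add N _ _
    _ ≤ (l + K₁ * l ^ 2) + κ * (K₀ * v ^ 2) := by
      gcongr
      exact (hN₁ _).trans (by gcongr)
    _ ≤ (l + K₁ * v ^ 2) + κ * (K₀ * v ^ 2) := by gcongr
    _ = _ := by ring

/-- The comparison of the variations of a curve and of its left trace. -/
theorem exists_variation_comparison [I.Boundaryless] (hN : ∀ v, N v = 0 → v = 0)
    (hr1 : 1 ≤ r) (hr2 : r < 2) :
    ∃ K : ℝ, 0 < K ∧ ∀ (a b : ℝ) (γ : ℝ → G), a < b → ContMDiffOn 𝓘(ℝ, ℝ) I 1 γ (Icc a b) →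
      rVariation (seminormEDist N) r a b (modelTrace I a b γ) < ⊤ ∧
      rVariation (leftInvariantEDist I (G := G) N) r a b γ ≤
        rVariation (seminormEDist N) r a b (modelTrace I a b γ) + ENNReal.ofReal K *
          min (rVariation (seminormEDist N) r a b (modelTrace I a b γ) ^ 2)
            (rVariation (seminormEDist N) r a b (modelTrace I a b γ) ^ r) ∧
      rVariation (seminormEDist N) r a b (modelTrace I a b γ) ≤
        rVariation (leftInvariantEDist I (G := G) N) r a b γ + ENNReal.ofReal K *
          min (rVariation (leftInvariantEDist I (G := G) N) r a b γ ^ 2)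
            (rVariation (leftInvariantEDist I (G := G) N) r a b γ ^ r) := by
  obtain ⟨ρ, C, A, hB⟩ := exists_chartBounds I G
  obtain ⟨κ, hκ, hN₁, hN₂⟩ := exists_seminorm_equiv N hN
  have hself : ∀ g : G, leftInvariantEDist I (G := G) N g g = 0 := fun g ↦
    leftInvariantEDist_self I N
  obtain ⟨δ₁, hδ₁, hδ₁1, K₁, hK₁, h₁⟩ :=
    exists_leftInvariantEDist_le (G := G) hB hκ hN₁ hN₂ hr1 hr2
  obtain ⟨δ₂, hδ₂, hδ₂1, K₂, hK₂, h₂⟩ :=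
    exists_seminormEDist_le (G := G) hB hκ hN₁ hN₂ hr1 hr2
  set C₁ := 3 * (1 + K₁) / δ₁ ^ 2
  set C₂ := 3 * (1 + K₂) / δ₂ ^ 2
  have hC₁ : 0 < C₁ := by positivity
  have hC₂ : 0 < C₂ := by positivity
  refine ⟨max C₁ C₂, by positivity, fun a b γ hab hγ ↦ ?_⟩
  obtain ⟨M, hM0, hM⟩ := exists_rVariation_modelTrace_le (N := N) hB (by linarith) hN₁ hr1 hab hγ
  have fine : ∀ η > 0, ∃ h > 0, ∀ s t, a ≤ s → s ≤ t → t ≤ b → t - s ≤ h →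
      rVariation (seminormEDist N) r s t (modelTrace I a b γ) ≤ ENNReal.ofReal η := by
    intro η hη
    refine ⟨η / (M + 1), by positivity, fun s t has hst htb hh ↦ (hM s t has hst htb).trans ?_⟩
    refine ENNReal.ofReal_le_ofReal ?_
    rw [le_div_iff₀ (by positivity)] at hh
    nlinarith
  have forward : ∀ s t, a ≤ s → s ≤ t → t ≤ b → _ := fun s t has hst htb ↦
    rVariation_le_of_local hr1 hr2 hδ₁ hδ₁1 hK₁ hst hself (leftInvariantEDist_triangle I N)
      seminormEDist_self
      (fun u w h1 h2 h3 ↦ h₁ a b γ hab hγ u w (has.trans h1) h2 (h3.trans htb))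
      ((fine δ₁ hδ₁).imp fun h hh ↦ ⟨hh.1, fun u w h1 h2 h3 ↦
        hh.2 u w (has.trans h1) h2 (h3.trans htb)⟩)
  have fine₂ : ∃ h > 0, ∀ s t, a ≤ s → s ≤ t → t ≤ b → t - s ≤ h →
      rVariation (leftInvariantEDist I (G := G) N) r s t γ ≤ ENNReal.ofReal δ₂ := by
    set η := δ₂ / (1 + C₁) with hη
    have hη0 : 0 < η := by positivity
    have hη1 : η ≤ 1 := by rw [hη, div_le_one (by positivity)]; linarith
    refine (fine η hη0).imp fun h hh ↦ ⟨hh.1, fun s t has hst htb hsth ↦ ?_⟩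
    have hV := hh.2 s t has hst htb hsth
    refine (forward s t has hst htb).trans ?_
    calc _ ≤ ENNReal.ofReal η + ENNReal.ofReal C₁ * ENNReal.ofReal η ^ 2 := by
          gcongr
          exact (min_le_left _ _).trans (by gcongr)
      _ = ENNReal.ofReal (η + C₁ * η ^ 2) := by
          rw [← ENNReal.ofReal_pow hη0.le, ← ENNReal.ofReal_mul hC₁.le,
            ← ENNReal.ofReal_add hη0.le (by positivity)]
      _ ≤ _ := by
          refine ENNReal.ofReal_le_ofReal ?_
          have : η * (1 + C₁) = δ₂ := by rw [hη]; field_simp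
          nlinarith [mul_nonneg hC₁.le (mul_nonneg hη0.le (sub_nonneg.2 hη1))]
  have backward := rVariation_le_of_local hr1 hr2 hδ₂ hδ₂1 hK₂ hab.le seminormEDist_self
    seminormEDist_triangle hself (h₂ a b γ hab hγ) fine₂
  refine ⟨(hM a b le_rfl hab.le le_rfl).trans_lt ENNReal.ofReal_lt_top,
    (forward a b le_rfl hab.le le_rfl).trans ?_, backward.trans ?_⟩
  · gcongr; exact le_max_left _ _
  · gcongr; exact le_max_right _ _

end Main

end LieVariation

end

theorem mainTheorem6
    {E : Type*} [NormedAddCommGroup E] [NormedSpace ℝ E] [FiniteDimensional ℝ E]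
    {H : Type*} [TopologicalSpace H] (I : ModelWithCorners ℝ E H) [I.Boundaryless]
    {G : Type*} [TopologicalSpace G] [ChartedSpace H G] [Group G] [LieGroup I ∞ G]
    [ConnectedSpace G]
    (N : Seminorm ℝ (GroupLieAlgebra I G)) (hN : ∀ v, N v = 0 → v = 0)
    (r : ℝ) (hr1 : 1 ≤ r) (hr2 : r < 2) :
    ∃ C : ℝ, 0 < C ∧
      ∀ (a b : ℝ) (_ : a ≤ b) (γ : ℝ → G) (_ : ContMDiffOn 𝓘(ℝ, ℝ) I ∞ γ (Set.Icc a b)),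
        LieVariation.groupVariation I N r a b γ < ⊤ ∧
        LieVariation.traceVariation I N r a b γ < ⊤ ∧
        LieVariation.groupVariation I N r a b γ ≤
          LieVariation.traceVariation I N r a b γ +
            ENNReal.ofReal C * min (LieVariation.traceVariation I N r a b γ ^ 2)
              (LieVariation.traceVariation I N r a b γ ^ r) ∧
        LieVariation.traceVariation I N r a b γ ≤
          LieVariation.groupVariation I N r a b γ +
            ENNReal.ofReal C * min (LieVariation.groupVariation I N r a b γ ^ 2)
              (LieVariation.groupVariation I N r a b γ ^ r) := by
  obtain ⟨C, hC, h⟩ :=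
    LieVariation.exists_variation_comparison (I := I) (G := G) (N := N) hN hr1 hr2
  refine ⟨C, hC, fun a b hab γ hγ ↦ ?_⟩
  rcases hab.eq_or_lt with rfl | hab
  · have hr0 : 0 < r := by linarith
    have h1 : LieVariation.groupVariation I N r a a γ = 0 :=
      LieVariation.rVariation_self (fun g ↦ LieVariation.leftInvariantEDist_self I N) hr0
    have h2 : LieVariation.traceVariation I N r a a γ = 0 :=
      LieVariation.rVariation_self (d := LieVariation.seminormEDist (E := E) N)
        LieVariation.seminormEDist_self hr0
    simp [h1, h2]
  · obtain ⟨hfin, h1, h2⟩ := h a b γ hab (hγ.of_le (by simp))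
    refine ⟨h1.trans_lt ?_, hfin, h1, h2⟩
    refine ENNReal.add_lt_top.2 ⟨hfin, ENNReal.mul_lt_top ENNReal.ofReal_lt_top ?_⟩
    exact (min_le_left _ _).trans_lt (ENNReal.pow_lt_top hfin)
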